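/- Let $n\ge 2$ be an integer, $0\le\alpha<1$, $\mu\ge 0$, $p>1$ and $R>0$. Let $u_0\in C^2(\mathbf R^n)$ and $u_1\in C^1(\mathbf R^n)$ be real-valued, nonnegative, each not identically zero, with $\operatorname{supp}u_0,\ \operatorname{supp}u_1\subset\{|x|\le R\}$. For $\varepsilon>0$ consider the Cauchy problem $$u_{tt}-t^{-2\alpha}\Delta u+\frac{\mu}{t}u_t=|\nabla_x u|^p\quad (t>1,\ x\in\mathbf R^n),\qquad u(1,x)=\varepsilon u_0(x),\quad u_t(1,x)=\varepsilon u_1(x),$$ and let its lifespan $T_\varepsilon$ be the supremum of all $T\in(1,\infty]$ for which it has a classical solution $u\in C^2([1,T)\times\mathbf R^n)$. Put $$\gamma'(n,p,\alpha,\mu)=-p^2\Bigl(n+1+\frac{\mu-\alpha}{1-\alpha}\Bigr)+p\Bigl(n+1+\frac{\mu+3\alpha}{1-\alpha}\Bigr)+2,\qquad p_0'(n,\alpha,\mu)=1+\frac{1+\alpha}{(n+1)(1-\alpha)+\mu-1},$$ and let $p_c'(n,\alpha,\mu)$ denote the positive root of the equation $\gamma'(n,\cdot,\alpha,\mu)=0$;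 the condition $p<p_c'(n,\alpha,\mu)$ is understood to include that this root exists, and $p<p_0'(n,\alpha,\mu)$ to include that the denominator in $p_0'$ is nonzero. Assume that $p<p_c'(n,\alpha,\mu)$ or $p<p_0'(n,\alpha,\mu)$. Then $T_\varepsilon<\infty$ for every $\varepsilon>0$ (in particular, there is no classical solution on $[1,\infty)\times\mathbf R^n$), and there are constants $\varepsilon_0>0$ and $C>0$, depending on $n,p,\alpha,\mu,R,u_0,u_1$ but not on $\varepsilon$, such that for all $0<\varepsilon\le\varepsilon_0$ $$T_\varepsilon\le C\,\varepsilon^{\frac{-2p(p-1)}{(1-\alpha)\gamma'(n,p,\alpha,\mu)}}\quad\text{if } p<p_c'(n,\alpha,\mu),$$ $$T_\varepsilon\le C\,\varepsilon^{-\frac{p-1}{\{1-\mu-(n+1)(1-\alpha)\}(p-1)+1+\alpha}}\quad\text{if } p<p_0'(n,\alpha,\mu).$$ -/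

import Mathlib

namespace DampedWave

/-- The `C²` classical solutions `u = u(t, x)` on `[1, T) × ℝⁿ`, `1 < T ≤ ∞`, of
`u_tt - t^(-2α) Δu + (μ/t) u_t = |∇ₓu|^p` with `u(1, ·) = ε u₀` and `u_t(1, ·) = ε u₁`.
The derivatives on the boundary `t = 1` are one-sided in time. -/
structure IsClassicalSolution {n : ℕ} (α μ p ε : ℝ) (u₀ u₁ : EuclideanSpace ℝ (Fin n) → ℝ)
    (T : EReal) (u : ℝ → EuclideanSpace ℝ (Fin n) → ℝ) : Prop where
  one_lt : 1 < T
  contDiffOn : ContDiffOn ℝ 2 (fun z : ℝ × EuclideanSpace ℝ (Fin n) => u z.1 z.2)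
    {z | 1 ≤ z.1 ∧ (z.1 : EReal) < T}
  equation : ∀ (t : ℝ) (x : EuclideanSpace ℝ (Fin n)), 1 < t → (t : EReal) < T →
    deriv (deriv (fun s => u s x)) t - 1 / t ^ (2 * α) * Laplacian.laplacian (u t) x
      + μ / t * deriv (fun s => u s x) t = ‖gradient (u t) x‖ ^ p
  initial : ∀ x, u 1 x = ε * u₀ x
  initial_deriv : ∀ x, derivWithin (fun s => u s x) (Set.Ici 1) 1 = ε * u₁ x

/-- The lifespan `T_ε`: the supremum of all `T ∈ (1, ∞]` for which there is a classical solution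
on `[1, T) × ℝⁿ`. -/
noncomputable def lifespan {n : ℕ} (α μ p ε : ℝ) (u₀ u₁ : EuclideanSpace ℝ (Fin n) → ℝ) : EReal :=
  sSup {T : EReal | ∃ u, IsClassicalSolution α μ p ε u₀ u₁ T u}

/-- The quadratic polynomial `γ'(n, p, α, μ)`. -/
noncomputable def gammaPrime (n : ℕ) (p α μ : ℝ) : ℝ :=
  -p ^ 2 * ((n : ℝ) + 1 + (μ - α) / (1 - α))
    + p * ((n : ℝ) + 1 + (μ + 3 * α) / (1 - α)) + 2

/-- `q` is the exponent `p_c'(n, α, μ)`, the positive root of `γ'(n, ·, α, μ)`. For `n ≥ 2`,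
`0 ≤ α < 1`, `μ ≥ 0` there is at most one such `q`, and one exists exactly when
`n + 1 + (μ - α) / (1 - α) > 0`. -/
def IsPcPrime (n : ℕ) (α μ q : ℝ) : Prop :=
  0 < q ∧ gammaPrime n q α μ = 0

/-- The exponent `p_0'(n, α, μ)`. -/
noncomputable def p0Prime (n : ℕ) (α μ : ℝ) : ℝ :=
  1 + (1 + α) / (((n : ℝ) + 1) * (1 - α) + μ - 1)

end DampedWave

namespace DampedWave

open Set MeasureTheory Filter Topology
open scoped Gradient InnerProductSpace

/-! ### Comparison for damped second-order inequalities, and Kato-type blow-up -/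

section

/-! Integrating the equation in space removes the Laplacian: the mean F(t) = ∫ u satisfies F'' +
(μ/t) F' = ∫ |∇u|^p. A weighted energy estimate (`IsClassicalSolution.eq_zero_of_lt_norm`) confines
u(t, ·) to the ball of radius A(t) + R, where A(t) = ∫₁ᵗ s^(-α) ds = O(t^(1-α)). Hölder's inequality
on that ball, together with F ≤ (A + R) ∫ |∇u|, gives the closed inequality F'' + (μ/t) F' ≥ c
t^(-q) F^p with q = (1-α)(n(p-1) + p). Comparing F on [a, 2a] with an explicit function singular at
2a (`not_damped_superlinear`) shows that if the solution outlives 2a and F(a) > k, then a^(2-q)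
k^(p-1) is bounded by a constant (`Admissible.exists_blowup_criterion`).

A lower bound F(a) ≥ c ε^r a^σ with θ = σ(p-1) + 2 - q > 0 therefore bounds the lifespan by a
multiple of ε^(-r(p-1)/θ). There are two such bounds. Dropping the nonlinearity gives F ≥ c ε
t^(1-μ), which is the case p < p_0' (`Admissible.exists_mean_lower_linear`).

For p < p_c' the source is kept. The exponential moments ∫ u e^⟨ξ,x⟩ satisfy v'' + (μ/t) v' ≥
t^(-2α) |ξ|² v, so they dominate a multiple of ε t^b e^(|ξ|A(t)), b = (α-μ)/2 - δ, for |ξ| bounded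
and large enough in terms of δ (`exists_expMoment_lower`). Integration by parts passes this on to
the moments of |∇u|, a function that is nonnegative whatever the sign of u. Averaging over a thin
shell of ξ with a Gaussian weight (`exists_integral_lower_of_expMoments`) yields ∫ |∇u| ≥ c ε t^(b +
(1-α)(n-1)/2). Hölder's inequality turns this into a lower bound for the source, and comparison with
a parabola gives F ≥ c ε^p a^(2+e) (`Admissible.exists_mean_lower_superlinear`). With δ = (1-α)/p
the resulting θ is (1-α)γ'/2. -/

theorem mono_of_damped_nonneg {a c μ : ℝ} (ha : 0 < a) {w w₁ w₂ : ℝ → ℝ}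
    (hw : ContinuousOn w (Icc a c)) (hw₁ : ContinuousOn w₁ (Icc a c))
    (hd : ∀ t ∈ Ioo a c, HasDerivAt w (w₁ t) t) (hd₁ : ∀ t ∈ Ioo a c, HasDerivAt w₁ (w₂ t) t)
    (h1 : 0 ≤ w₁ a) (h : ∀ t ∈ Ioo a c, 0 ≤ w₂ t + μ / t * w₁ t) :
    ∀ t ∈ Icc a c, w a ≤ w t ∧ 0 ≤ w₁ t := by
  intro t ht
  have hac : a ≤ c := ht.1.trans ht.2
  have hpos : ∀ s ∈ Icc a c, 0 < s := fun s hs => ha.trans_le hs.1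
  -- The integrating factor s^μ absorbs the damping: (s^μ w₁)' = s^μ (w₂ + (μ/s) w₁).
  have hz : MonotoneOn (fun s => s ^ μ * w₁ s) (Icc a c) := by
    apply monotoneOn_of_hasDerivWithinAt_nonneg (convex_Icc a c)
      (f' := fun s => μ * s ^ (μ - 1) * w₁ s + s ^ μ * w₂ s)
    · exact (continuousOn_id.rpow_const fun s hs => Or.inl (hpos s hs).ne').mul hw₁
    · intro s hs
      rw [interior_Icc] at hs
      exact ((Real.hasDerivAt_rpow_const (Or.inl (ha.trans hs.1).ne')).mul
        (hd₁ s hs)).hasDerivWithinAt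
    · intro s hs
      rw [interior_Icc] at hs
      have h0 : 0 < s := ha.trans hs.1
      have e : μ * s ^ (μ - 1) * w₁ s + s ^ μ * w₂ s = s ^ μ * (w₂ s + μ / s * w₁ s) := by
        rw [Real.rpow_sub_one h0.ne']; ring
      rw [e]
      exact mul_nonneg (Real.rpow_nonneg h0.le _) (h s hs)
  have hw₁n : ∀ s ∈ Icc a c, 0 ≤ w₁ s := by
    intro s hs
    have h2 := hz (left_mem_Icc.2 hac) hs hs.1
    have h3 : 0 ≤ s ^ μ * w₁ s := (mul_nonneg (Real.rpow_nonneg ha.le _) h1).trans h2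
    exact nonneg_of_mul_nonneg_right h3 (Real.rpow_pos_of_pos (hpos s hs) _)
  have hm : MonotoneOn w (Icc a c) := by
    apply monotoneOn_of_hasDerivWithinAt_nonneg (convex_Icc a c) hw (f' := w₁)
    · intro s hs
      rw [interior_Icc] at hs
      exact (hd s hs).hasDerivWithinAt
    · intro s hs
      rw [interior_Icc] at hs
      exact hw₁n s (Ioo_subset_Icc_self hs)
  exact ⟨hm (left_mem_Icc.2 hac) ht ht.1, hw₁n t ht⟩

/-- Before a first zero c of w the inequality is in force, so w is nondecreasing up to c and w(c) ≥
w(a) > 0, a contradiction. Asking for the inequality only where w > 0 is what makes this a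
comparison principle: w will be a solution minus a subsolution, and monotone right-hand sides can be
compared only where that difference is positive. -/
theorem initial_le_of_damped_nonneg {a b μ : ℝ} (ha : 0 < a) {w w₁ w₂ : ℝ → ℝ}
    (hw : ContinuousOn w (Icc a b)) (hw₁ : ContinuousOn w₁ (Icc a b))
    (hd : ∀ t ∈ Ioo a b, HasDerivAt w (w₁ t) t) (hd₁ : ∀ t ∈ Ioo a b, HasDerivAt w₁ (w₂ t) t)
    (h0 : 0 < w a) (h1 : 0 ≤ w₁ a)
    (h : ∀ t ∈ Ioo a b, 0 < w t → 0 ≤ w₂ t + μ / t * w₁ t) :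
    ∀ t ∈ Icc a b, w a ≤ w t ∧ 0 ≤ w₁ t := by
  have key : ∀ c ∈ Icc a b, (∀ t ∈ Ioo a c, 0 < w t) → ∀ t ∈ Icc a c, w a ≤ w t ∧ 0 ≤ w₁ t := by
    intro c hc hp
    have s1 : Icc a c ⊆ Icc a b := Icc_subset_Icc_right hc.2
    have s2 : Ioo a c ⊆ Ioo a b := Ioo_subset_Ioo_right hc.2
    exact mono_of_damped_nonneg (μ := μ) ha (hw.mono s1) (hw₁.mono s1) (fun t ht => hd t (s2 ht))
      (fun t ht => hd₁ t (s2 ht)) h1 (fun t ht => h t (s2 ht) (hp t ht))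
  have hpos : ∀ t ∈ Icc a b, 0 < w t := by
    by_contra hcon
    push Not at hcon
    have hK : IsCompact (Icc a b ∩ w ⁻¹' Iic 0) :=
      isCompact_Icc.of_isClosed_subset (hw.preimage_isClosed_of_isClosed isClosed_Icc isClosed_Iic)
        inter_subset_left
    obtain ⟨t, ht, ht0⟩ := hcon
    obtain ⟨c, hc, hmin⟩ := hK.exists_isLeast ⟨t, ht, ht0⟩
    have := (key c hc.1 (fun s hs => by
      by_contra hn
      exact absurd (hmin ⟨⟨hs.1.le, hs.2.le.trans hc.1.2⟩, not_lt.1 hn⟩) (not_le.2 hs.2)) c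
        ⟨hc.1.1, le_rfl⟩).1
    have h2 : w c ≤ 0 := hc.2
    linarith
  intro t ht
  exact key b ⟨ht.1.trans ht.2, le_rfl⟩ (fun s hs => hpos s (Ioo_subset_Icc_self hs)) t ht

/-- Kato-type blow-up: a nondecreasing-at-`a` solution of a damped superlinear inequality
that is large enough at `a` cannot live on `[a, 2a]`. -/
theorem not_damped_superlinear {a μ p k M : ℝ} (ha : 1 ≤ a) (hμ : 0 ≤ μ) (hp : 1 < p) (hk : 0 < k)
    (hM : 4 * (2 / (p - 1)) * (2 / (p - 1) + 2 + μ) ≤ M * a ^ 2 * k ^ (p - 1))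
    {f f₁ f₂ : ℝ → ℝ}
    (hf : ContinuousOn f (Icc a (2 * a))) (hf₁ : ContinuousOn f₁ (Icc a (2 * a)))
    (hd : ∀ t ∈ Ioo a (2 * a), HasDerivAt f (f₁ t) t)
    (hd₁ : ∀ t ∈ Ioo a (2 * a), HasDerivAt f₁ (f₂ t) t)
    (h0 : k < f a) (h1 : 0 ≤ f₁ a)
    (h : ∀ t ∈ Ioo a (2 * a), 0 < f t → M * f t ^ p ≤ f₂ t + μ / t * f₁ t) : False := by
  -- This exponent satisfies -m p = -m - 2, so the barrier's second derivative and its p-th power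
  -- have the same singularity.
  set m : ℝ := 2 / (p - 1) with hm
  have hp1 : 0 < p - 1 := by linarith
  have hm0 : 0 < m := by positivity
  have ha0 : 0 < a := by linarith
  have hM0 : 0 < M := by
    have : 0 < M * a ^ 2 * k ^ (p - 1) := lt_of_lt_of_le (by positivity) hM
    have h2 : 0 < a ^ 2 * k ^ (p - 1) := by positivity
    rw [mul_assoc] at this
    exact pos_of_mul_pos_left this h2.le
  -- The barrier y = k z^(-m) starts at k with zero slope and blows up at 2a. The hypothesis `hM`
  -- makes it a subsolution, so it stays below f, which is bounded on the compact interval.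
  let z : ℝ → ℝ := fun t => 1 - ((t - a) / a) ^ 2
  let y : ℝ → ℝ := fun t => k * z t ^ (-m)
  let y₁ : ℝ → ℝ := fun t => 2 * k * m / a * ((t - a) / a) * z t ^ (-m - 1)
  let y₂ : ℝ → ℝ := fun t => 2 * k * m / a ^ 2 * z t ^ (-m - 1)
    + 4 * k * m * (m + 1) / a ^ 2 * ((t - a) / a) ^ 2 * z t ^ (-m - 2)
  have hσ : ∀ t ∈ Ico a (2 * a), 0 ≤ (t - a) / a ∧ (t - a) / a < 1 := by
    intro t ht
    refine ⟨div_nonneg (by linarith [ht.1]) ha0.le, (div_lt_one ha0).2 (by linarith [ht.2])⟩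
  have hz0 : ∀ t ∈ Ico a (2 * a), 0 < z t ∧ z t ≤ 1 := by
    intro t ht
    obtain ⟨q1, q2⟩ := hσ t ht
    constructor
    · simp only [z]; nlinarith
    · simp only [z]; nlinarith
  have hzd : ∀ t, HasDerivAt z (-(2 / a * ((t - a) / a))) t := by
    intro t
    have := ((((hasDerivAt_id t).sub_const a).div_const a).pow 2).const_sub 1
    convert! this using 1
    simp; ring
  have hyd : ∀ t ∈ Ico a (2 * a), HasDerivAt y (y₁ t) t := by
    intro t ht
    have := ((hzd t).rpow_const (p := -m) (Or.inl (hz0 t ht).1.ne')).const_mul k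
    convert! this using 1
    simp only [y₁]; ring
  have hyd₁ : ∀ t ∈ Ico a (2 * a), HasDerivAt y₁ (y₂ t) t := by
    intro t ht
    have h3 := (hzd t).rpow_const (p := -m - 1) (Or.inl (hz0 t ht).1.ne')
    have h4 := (((hasDerivAt_id t).sub_const a).div_const a).const_mul (2 * k * m / a)
    have := h4.mul h3
    convert! this using 1
    simp only [y₂, id]
    rw [show -m - 1 - 1 = -m - 2 by ring]
    field_simp
    ring
  have hyode : ∀ t ∈ Ico a (2 * a), y₂ t + μ / t * y₁ t ≤ M * y t ^ p := by
    intro t ht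
    obtain ⟨q1, q2⟩ := hσ t ht
    obtain ⟨z1, z2⟩ := hz0 t ht
    have e1 : z t ^ (-m - 1) ≤ z t ^ (-m - 2) :=
      Real.rpow_le_rpow_of_exponent_ge z1 z2 (by linarith)
    have zp : 0 < z t ^ (-m - 2) := Real.rpow_pos_of_pos z1 _
    have zp1 : 0 < z t ^ (-m - 1) := Real.rpow_pos_of_pos z1 _
    have e2 : y t ^ p = k * k ^ (p - 1) * z t ^ (-m - 2) := by
      simp only [y]
      rw [Real.mul_rpow hk.le (Real.rpow_nonneg z1.le _), ← Real.rpow_mul z1.le]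
      have : -m * p = -m - 2 := by rw [hm]; field_simp; ring
      rw [this, Real.rpow_sub_one hk.ne']
      field_simp
    have e3 : y₂ t ≤ (2 * k * m / a ^ 2 + 4 * k * m * (m + 1) / a ^ 2) * z t ^ (-m - 2) := by
      simp only [y₂]
      rw [add_mul]
      have s1 : ((t - a) / a) ^ 2 ≤ 1 := by nlinarith
      gcongr
      exact mul_le_of_le_one_right (by positivity) s1
    have e4 : μ / t * y₁ t ≤ (2 * k * m * μ / a ^ 2) * z t ^ (-m - 2) := by
      have t1 : μ / t ≤ μ / a := div_le_div_of_nonneg_left hμ ha0 ht.1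
      have t2 : y₁ t ≤ 2 * k * m / a * z t ^ (-m - 2) := by
        simp only [y₁]
        have : 2 * k * m / a * ((t - a) / a) ≤ 2 * k * m / a :=
          mul_le_of_le_one_right (by positivity) q2.le
        gcongr
      have t3 : 0 ≤ y₁ t := by simp only [y₁]; positivity
      calc μ / t * y₁ t ≤ μ / a * (2 * k * m / a * z t ^ (-m - 2)) := by gcongr
        _ = _ := by ring
    have e5 : 2 * k * m / a ^ 2 + 4 * k * m * (m + 1) / a ^ 2 + 2 * k * m * μ / a ^ 2
        ≤ M * (k * k ^ (p - 1)) := by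
      have : 2 * k * m / a ^ 2 + 4 * k * m * (m + 1) / a ^ 2 + 2 * k * m * μ / a ^ 2
        = k / a ^ 2 * (m * (4 * m + 6 + 2 * μ)) := by field_simp; ring
      rw [this]
      have h5 : m * (4 * m + 6 + 2 * μ) ≤ M * a ^ 2 * k ^ (p - 1) := by
        refine le_trans ?_ hM
        nlinarith
      calc k / a ^ 2 * (m * (4 * m + 6 + 2 * μ)) ≤ k / a ^ 2 * (M * a ^ 2 * k ^ (p - 1)) := by
            gcongr
        _ = _ := by field_simp
    rw [e2]
    nlinarith
  have hya : y a = k := by simp [y, z]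
  have hy1a : y₁ a = 0 := by simp [y₁]
  have hle : ∀ t ∈ Ico a (2 * a), y t ≤ f t := by
    intro t ht
    have s1 : Icc a t ⊆ Icc a (2 * a) := Icc_subset_Icc_right ht.2.le
    have s2 : Ioo a t ⊆ Ioo a (2 * a) := Ioo_subset_Ioo_right ht.2.le
    have s3 : Icc a t ⊆ Ico a (2 * a) := fun s hs => ⟨hs.1, hs.2.trans_lt ht.2⟩
    have := (initial_le_of_damped_nonneg (μ := μ) ha0 (w := fun s => f s - y s)
      (w₁ := fun s => f₁ s - y₁ s) (w₂ := fun s => f₂ s - y₂ s) (b := t)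
      ((hf.mono s1).sub fun s hs => (hyd s (s3 hs)).continuousAt.continuousWithinAt)
      ((hf₁.mono s1).sub fun s hs => (hyd₁ s (s3 hs)).continuousAt.continuousWithinAt)
      (fun s hs => (hd s (s2 hs)).sub (hyd s (s3 (Ioo_subset_Icc_self hs))))
      (fun s hs => (hd₁ s (s2 hs)).sub (hyd₁ s (s3 (Ioo_subset_Icc_self hs))))
      (by simp only [hya]; linarith) (by simp only [hy1a]; linarith)
      (fun s hs hpos => by
        have hs3 := s3 (Ioo_subset_Icc_self hs)
        have hy0 : 0 < y s := mul_pos hk (Real.rpow_pos_of_pos (hz0 s hs3).1 _)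
        have a1 := h s (s2 hs) (by linarith)
        have a2 := hyode s hs3
        have a3 : y s ^ p ≤ f s ^ p := Real.rpow_le_rpow hy0.le (by linarith) (by linarith)
        have a4 := mul_le_mul_of_nonneg_left a3 hM0.le
        have : f₂ s - y₂ s + μ / s * (f₁ s - y₁ s) =
          (f₂ s + μ / s * f₁ s) - (y₂ s + μ / s * y₁ s) := by ring
        rw [this]
        linarith) t ⟨ht.1, le_rfl⟩).1
    simp only [hya] at this
    linarith
  obtain ⟨B, hB⟩ := isCompact_Icc.bddAbove_image hf
  have hlim : Tendsto y (𝓝[<] (2 * a)) atTop := by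
    have hz : Tendsto z (𝓝[<] (2 * a)) (𝓝[>] 0) := by
      apply tendsto_nhdsWithin_of_tendsto_nhds_of_eventually_within
      · have : Tendsto z (𝓝 (2 * a)) (𝓝 (z (2 * a))) := (hzd (2 * a)).continuousAt
        have e : z (2 * a) = 0 := by simp only [z]; field_simp; ring
        rw [e] at this
        exact this.mono_left nhdsWithin_le_nhds
      · filter_upwards [Ioo_mem_nhdsLT (show a < 2 * a by linarith)] with t ht
        exact (hz0 t (Ioo_subset_Ico_self ht)).1
    exact ((tendsto_rpow_neg_nhdsGT_zero (show -m < 0 by linarith)).comp hz).const_mul_atTop hk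
  obtain ⟨t, ht1, ht2⟩ := ((hlim.eventually_gt_atTop B).and
    (Ioo_mem_nhdsLT (show a < 2 * a by linarith))).exists
  have := hle t (Ioo_subset_Ico_self ht2)
  have h6 := hB (mem_image_of_mem f (Ioo_subset_Icc_self ht2))
  linarith

end

/-! ### Integration by parts, differentiation under the integral, and the space-time slab -/

section

section Calculus

variable {E : Type*} [NormedAddCommGroup E] [InnerProductSpace ℝ E] [FiniteDimensional ℝ E]

theorem inner_gradient_eq_sum {f g : E → ℝ} (x : E) :
    ⟪∇ f x, ∇ g x⟫_ℝ = ∑ i, fderiv ℝ f x (stdOrthonormalBasis ℝ E i)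
      * fderiv ℝ g x (stdOrthonormalBasis ℝ E i) := by
  rw [← (stdOrthonormalBasis ℝ E).sum_inner_mul_inner]
  refine Finset.sum_congr rfl fun i _ => ?_
  rw [inner_gradient_left, inner_gradient_right]
  simp

theorem laplacian_eq_sum_fderiv {g : E → ℝ} (hg : ContDiff ℝ 2 g) (x : E) :
    Laplacian.laplacian g x = ∑ i, fderiv ℝ (fun y => fderiv ℝ g y (stdOrthonormalBasis ℝ E i)) x
      (stdOrthonormalBasis ℝ E i) := by
  rw [InnerProductSpace.laplacian_eq_iteratedFDeriv_stdOrthonormalBasis]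
  refine Finset.sum_congr rfl fun i _ => ?_
  rw [iteratedFDeriv_two_apply]
  have hd : DifferentiableAt ℝ (fderiv ℝ g) x :=
    ((hg.fderiv_right (m := 1) (by norm_num)).differentiable one_ne_zero) x
  rw [fderiv_clm_apply hd (differentiableAt_const _)]
  simp

theorem continuous_gradient {f : E → ℝ} (hf : ContDiff ℝ 1 f) : Continuous (∇ f) :=
  (InnerProductSpace.toDual ℝ E).symm.continuous.comp (hf.continuous_fderiv one_ne_zero)

theorem continuous_laplacian {g : E → ℝ} (hg : ContDiff ℝ 2 g) :
    Continuous (Laplacian.laplacian g) := by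
  have e : Laplacian.laplacian g = fun x => ∑ i,
      fderiv ℝ (fun y => fderiv ℝ g y (stdOrthonormalBasis ℝ E i)) x
        (stdOrthonormalBasis ℝ E i) := funext (laplacian_eq_sum_fderiv hg)
  rw [e]
  refine continuous_finsetSum _ fun i _ => ?_
  have : ContDiff ℝ 1 fun y => fderiv ℝ g y (stdOrthonormalBasis ℝ E i) :=
    (hg.fderiv_right (m := 1) (by norm_num)).clm_apply contDiff_const
  exact (this.continuous_fderiv one_ne_zero).clm_apply continuous_const

variable [MeasurableSpace E] [BorelSpace E]

theorem hasDerivAt_integral_of_isCompact {K : Set E} (hK : IsCompact K) {a b : ℝ}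
    {f f' : ℝ → E → ℝ} (hf : ContinuousOn (Function.uncurry f) (Ioo a b ×ˢ univ))
    (hf' : ContinuousOn (Function.uncurry f') (Ioo a b ×ˢ univ))
    (hd : ∀ t ∈ Ioo a b, ∀ x, HasDerivAt (fun s => f s x) (f' t x) t)
    (hs : ∀ t ∈ Ioo a b, ∀ x, x ∉ K → f t x = 0)
    (hs' : ∀ t ∈ Ioo a b, ∀ x, x ∉ K → f' t x = 0) {t : ℝ} (ht : t ∈ Ioo a b) :
    HasDerivAt (fun s => ∫ x, f s x) (∫ x, f' t x) t := by
  have slice : ∀ {g : ℝ → E → ℝ}, ContinuousOn (Function.uncurry g) (Ioo a b ×ˢ univ) →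
      ∀ s ∈ Ioo a b, Continuous (g s) := by
    intro g hg s hs
    rw [← continuousOn_univ]
    exact hg.comp (f := fun x => (s, x)) (by fun_prop) (fun x _ => ⟨hs, mem_univ _⟩)
  -- The derivative is controlled only inside the open interval, so the dominating constant is taken
  -- on a compact [c, d] around t.
  obtain ⟨c, hct, hc⟩ := exists_between ht.1
  obtain ⟨d, htd, hdb⟩ := exists_between ht.2
  have hcd : Icc c d ⊆ Ioo a b := fun s hs => ⟨hct.trans_le hs.1, hs.2.trans_lt hdb⟩
  have hcomp : IsCompact (Icc c d ×ˢ K) := isCompact_Icc.prod hK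
  obtain ⟨C, hC⟩ := hcomp.exists_bound_of_continuousOn
    (hf'.mono (prod_mono hcd (subset_univ K)))
  have hK' : MeasurableSet K := hK.measurableSet
  refine (hasDerivAt_integral_of_dominated_loc_of_deriv_le (s := Icc c d)
    (bound := K.indicator fun _ => C) (Icc_mem_nhds hc htd) ?_ ?_ ?_ ?_ ?_ ?_).2
  · filter_upwards [Ioo_mem_nhds ht.1 ht.2] with s hs
    exact (slice hf s hs).aestronglyMeasurable
  · exact (slice hf t ht).integrable_of_hasCompactSupport
      (HasCompactSupport.intro hK fun x hx => hs t ht x hx)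
  · exact (slice hf' t ht).aestronglyMeasurable
  · refine Eventually.of_forall fun x s hs => ?_
    by_cases hx : x ∈ K
    · rw [indicator_of_mem hx]
      exact hC (s, x) ⟨hs, hx⟩
    · rw [indicator_of_notMem hx, hs' s (hcd hs) x hx, norm_zero]
  · exact (integrable_indicator_iff hK').2 (integrableOn_const hK.measure_lt_top.ne)
  · exact Eventually.of_forall fun x s hs => hd s (hcd hs) x

theorem integral_mul_fderiv_eq_neg {f g : E → ℝ} (hf : ContDiff ℝ 1 f) (hg : ContDiff ℝ 1 g)
    (hs : HasCompactSupport f) (v : E) :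
    ∫ x, f x * fderiv ℝ g x v = -∫ x, fderiv ℝ f x v * g x := by
  have cf : Continuous fun x => fderiv ℝ f x v :=
    (hf.continuous_fderiv one_ne_zero).clm_apply continuous_const
  have cg : Continuous fun x => fderiv ℝ g x v :=
    (hg.continuous_fderiv one_ne_zero).clm_apply continuous_const
  have sf : HasCompactSupport fun x => fderiv ℝ f x v := hs.fderiv_apply (𝕜 := ℝ) v
  apply integral_mul_fderiv_eq_neg_fderiv_mul_of_integrable
  · exact (cf.mul hg.continuous).integrable_of_hasCompactSupport sf.mul_right
  · exact (hf.continuous.mul cg).integrable_of_hasCompactSupport hs.mul_right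
  · exact (hf.continuous.mul hg.continuous).integrable_of_hasCompactSupport hs.mul_right
  · exact fun x _ => (hf.differentiable one_ne_zero) x
  · exact fun x _ => (hg.differentiable one_ne_zero) x

theorem integral_fderiv_mul_eq_neg {f g : E → ℝ} (hf : ContDiff ℝ 1 f) (hg : ContDiff ℝ 1 g)
    (hs : HasCompactSupport f) (v : E) :
    ∫ x, fderiv ℝ f x v * g x = -∫ x, f x * fderiv ℝ g x v := by
  rw [integral_mul_fderiv_eq_neg hf hg hs v, neg_neg]

/-- Green's first identity without boundary. -/
theorem integral_mul_laplacian_eq_neg {f g : E → ℝ} (hf : ContDiff ℝ 1 f) (hg : ContDiff ℝ 2 g)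
    (hs : HasCompactSupport f) :
    ∫ x, f x * Laplacian.laplacian g x = -∫ x, ⟪∇ f x, ∇ g x⟫_ℝ := by
  have hgi : ∀ i, ContDiff ℝ 1 fun y => fderiv ℝ g y (stdOrthonormalBasis ℝ E i) := fun i =>
    (hg.fderiv_right (m := 1) (by norm_num)).clm_apply contDiff_const
  simp_rw [inner_gradient_eq_sum, laplacian_eq_sum_fderiv hg, Finset.mul_sum]
  rw [integral_finsetSum, integral_finsetSum, ← Finset.sum_neg_distrib]
  · exact Finset.sum_congr rfl fun i _ => integral_mul_fderiv_eq_neg hf (hgi i) hs _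
  · intro i _
    refine (Continuous.mul ?_ (hgi i).continuous).integrable_of_hasCompactSupport
      (HasCompactSupport.mul_right (hs.fderiv_apply (𝕜 := ℝ) _))
    exact (hf.continuous_fderiv one_ne_zero).clm_apply continuous_const
  · intro i _
    refine (Continuous.mul hf.continuous ?_).integrable_of_hasCompactSupport hs.mul_right
    exact ((hgi i).continuous_fderiv one_ne_zero).clm_apply continuous_const

/-- Green's first identity when the function under the Laplacian has compact support. -/
theorem integral_mul_laplacian_eq_neg' {f g : E → ℝ} (hf : ContDiff ℝ 1 f) (hg : ContDiff ℝ 2 g)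
    (hs : HasCompactSupport g) :
    ∫ x, f x * Laplacian.laplacian g x = -∫ x, ⟪∇ f x, ∇ g x⟫_ℝ := by
  have hgi : ∀ i, ContDiff ℝ 1 fun y => fderiv ℝ g y (stdOrthonormalBasis ℝ E i) := fun i =>
    (hg.fderiv_right (m := 1) (by norm_num)).clm_apply contDiff_const
  have hsi : ∀ i, HasCompactSupport fun y => fderiv ℝ g y (stdOrthonormalBasis ℝ E i) := fun i =>
    hs.fderiv_apply (𝕜 := ℝ) _
  simp_rw [inner_gradient_eq_sum, laplacian_eq_sum_fderiv hg, Finset.mul_sum]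
  rw [integral_finsetSum, integral_finsetSum, ← Finset.sum_neg_distrib]
  · refine Finset.sum_congr rfl fun i _ => ?_
    have := integral_fderiv_mul_eq_neg (hgi i) hf (hsi i) (stdOrthonormalBasis ℝ E i)
    simp_rw [mul_comm (f _), mul_comm (fderiv ℝ f _ _)]
    exact this
  · intro i _
    refine (Continuous.mul ?_ (hgi i).continuous).integrable_of_hasCompactSupport
      (HasCompactSupport.mul_left (hsi i))
    exact (hf.continuous_fderiv one_ne_zero).clm_apply continuous_const
  · intro i _
    refine (Continuous.mul hf.continuous ?_).integrable_of_hasCompactSupport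
      (HasCompactSupport.mul_left ((hsi i).fderiv_apply (𝕜 := ℝ) _))
    exact ((hgi i).continuous_fderiv one_ne_zero).clm_apply continuous_const

end Calculus

/-- The closed-at-time-one space-time slab on which a classical solution lives. -/
def slab (n : ℕ) (T : EReal) : Set (ℝ × EuclideanSpace ℝ (Fin n)) :=
  {z | 1 ≤ z.1 ∧ (z.1 : EReal) < T}

/-- The interior of the slab. -/
def openSlab (n : ℕ) (T : EReal) : Set (ℝ × EuclideanSpace ℝ (Fin n)) :=
  {z | 1 < z.1 ∧ (z.1 : EReal) < T}

/-- The time derivative of `u`, one-sided at time one. -/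
noncomputable def velocity {n : ℕ} (T : EReal) (u : ℝ → EuclideanSpace ℝ (Fin n) → ℝ) (t : ℝ)
    (x : EuclideanSpace ℝ (Fin n)) : ℝ :=
  fderivWithin ℝ (Function.uncurry u) (slab n T) (t, x) (1, 0)

variable {n : ℕ} {T : EReal} {u : ℝ → EuclideanSpace ℝ (Fin n) → ℝ}

theorem isOpen_openSlab : IsOpen (openSlab n T) :=
  (isOpen_lt continuous_const continuous_fst).inter
    (isOpen_lt (continuous_coe_real_ereal.comp continuous_fst) continuous_const)

theorem openSlab_subset : openSlab n T ⊆ slab n T := fun _ hz => ⟨hz.1.le, hz.2⟩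

theorem slab_mem_nhds {z : ℝ × EuclideanSpace ℝ (Fin n)} (hz : z ∈ openSlab n T) :
    slab n T ∈ 𝓝 z :=
  mem_of_superset (isOpen_openSlab.mem_nhds hz) openSlab_subset

theorem uniqueDiffOn_slab (hT : 1 < T) : UniqueDiffOn ℝ (slab n T) := by
  have hI : slab n T = {t : ℝ | 1 ≤ t ∧ (t : EReal) < T} ×ˢ univ := by
    ext z; simp [slab]
  rw [hI]
  have hoc : OrdConnected {t : ℝ | 1 ≤ t ∧ (t : EReal) < T} := by
    refine ⟨fun a ha b hb c hc => ⟨ha.1.trans hc.1, lt_of_le_of_lt ?_ hb.2⟩⟩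
    exact_mod_cast hc.2
  refine (uniqueDiffOn_convex hoc.convex ?_).prod uniqueDiffOn_univ
  obtain ⟨b, hb1, hb2⟩ := EReal.exists_between_coe_real hT
  have hb1' : (1 : ℝ) < b := by exact_mod_cast hb1
  refine ⟨(1 + b) / 2, mem_interior_iff_mem_nhds.2 (mem_of_superset
    (Ioo_mem_nhds (a := 1) (b := b) (by linarith) (by linarith)) fun t ht => ⟨ht.1.le, ?_⟩)⟩
  exact lt_trans (by exact_mod_cast ht.2) hb2

/-! ### Regularity of a C² function on the slab and of its velocity -/

section Regularity

variable (hT : 1 < T) (hu : ContDiffOn ℝ 2 (Function.uncurry u) (slab n T))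
include hT hu

theorem continuousOn_fderivWithin_slab :
    ContinuousOn (fderivWithin ℝ (Function.uncurry u) (slab n T)) (slab n T) :=
  hu.continuousOn_fderivWithin (uniqueDiffOn_slab hT) (by norm_num)

theorem continuousOn_velocity : ContinuousOn (Function.uncurry (velocity T u)) (slab n T) :=
  (continuousOn_fderivWithin_slab hT hu).clm_apply continuousOn_const

omit hT in
theorem contDiff_slice {t : ℝ} (h1 : 1 ≤ t) (ht : (t : EReal) < T) : ContDiff ℝ 2 (u t) := by
  rw [← contDiffOn_univ]
  exact hu.comp (f := fun x => (t, x)) (by fun_prop) (fun x _ => ⟨h1, ht⟩)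

omit hT in
theorem hasFDerivAt_slice {t : ℝ} (h1 : 1 ≤ t) (ht : (t : EReal) < T)
    (x : EuclideanSpace ℝ (Fin n)) :
    HasFDerivAt (u t) ((fderivWithin ℝ (Function.uncurry u) (slab n T) (t, x)).comp
      (ContinuousLinearMap.inr ℝ ℝ (EuclideanSpace ℝ (Fin n)))) x := by
  have h := ((hu.differentiableOn (by norm_num)) (t, x) ⟨h1, ht⟩).hasFDerivWithinAt
  rw [← hasFDerivWithinAt_univ]
  exact h.comp (f := fun y => (t, y)) x (hasFDerivAt_prodMk_right t x).hasFDerivWithinAt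
    (fun y _ => ⟨h1, ht⟩)

omit hT in
theorem gradient_slice {t : ℝ} (h1 : 1 ≤ t) (ht : (t : EReal) < T)
    (x : EuclideanSpace ℝ (Fin n)) :
    ∇ (u t) x = (InnerProductSpace.toDual ℝ _).symm
      ((fderivWithin ℝ (Function.uncurry u) (slab n T) (t, x)).comp
      (ContinuousLinearMap.inr ℝ ℝ (EuclideanSpace ℝ (Fin n)))) := by
  rw [gradient, (hasFDerivAt_slice hu h1 ht x).fderiv]

theorem continuousOn_gradient_slice :
    ContinuousOn (Function.uncurry fun t => ∇ (u t)) (slab n T) := by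
  have : ContinuousOn (fun z => (InnerProductSpace.toDual ℝ _).symm
      ((fderivWithin ℝ (Function.uncurry u) (slab n T) z).comp
      (ContinuousLinearMap.inr ℝ ℝ (EuclideanSpace ℝ (Fin n))))) (slab n T) :=
    (InnerProductSpace.toDual ℝ _).symm.continuous.comp_continuousOn
      ((continuousOn_fderivWithin_slab hT hu).clm_comp continuousOn_const)
  exact this.congr fun z hz => gradient_slice hu hz.1 hz.2 z.2

omit hT in
theorem hasDerivAt_time {t : ℝ} (h1 : 1 < t) (ht : (t : EReal) < T)
    (x : EuclideanSpace ℝ (Fin n)) :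
    HasDerivAt (fun s => u s x) (velocity T u t x) t := by
  have hz : (t, x) ∈ openSlab n T := ⟨h1, ht⟩
  have h := (((hu.differentiableOn (by norm_num)) (t, x)
    (openSlab_subset hz)).hasFDerivWithinAt).hasFDerivAt (slab_mem_nhds hz)
  have h2 := h.comp_hasDerivAt (f := fun s => (s, x)) t
    ((hasDerivAt_id t).prodMk (hasDerivAt_const t x))
  exact h2

/-- Since 1 < T, the slab and `Ici 1` agree in time near 1. This lets the second initial condition
be read as a value of `velocity`, which is continuous up to the boundary. -/
theorem velocity_one (x : EuclideanSpace ℝ (Fin n)) :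
    velocity T u 1 x = derivWithin (fun s => u s x) (Ici 1) 1 := by
  have hT' : ((1 : ℝ) : EReal) < T := by exact_mod_cast hT
  have h := ((hu.differentiableOn (by norm_num)) (1, x) ⟨le_rfl, hT'⟩).hasFDerivWithinAt
  have h2 := h.comp_hasDerivWithinAt (f := fun s => (s, x)) (s := {t : ℝ | 1 ≤ t ∧ (t : EReal) < T})
    1 ((hasDerivAt_id (1 : ℝ)).prodMk (hasDerivAt_const 1 x)).hasDerivWithinAt
    (fun s hs => hs)
  have h3 : HasDerivWithinAt (fun s => u s x) (velocity T u 1 x) (Ici 1) 1 := by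
    refine HasDerivWithinAt.mono_of_mem_nhdsWithin h2 ?_
    have : {t : ℝ | (t : EReal) < T} ∈ 𝓝 (1 : ℝ) :=
      (isOpen_lt continuous_coe_real_ereal continuous_const).mem_nhds hT'
    filter_upwards [self_mem_nhdsWithin, mem_nhdsWithin_of_mem_nhds this] with s h4 h5
    exact ⟨h4, h5⟩
  exact (h3.derivWithin (uniqueDiffOn_Ici 1 1 self_mem_Ici)).symm

omit hT in
theorem contDiffOn_fderiv_openSlab :
    ContDiffOn ℝ 1 (fderiv ℝ (Function.uncurry u)) (openSlab n T) :=
  (hu.mono openSlab_subset).fderiv_of_isOpen isOpen_openSlab (by norm_num)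

omit hT hu in
theorem velocity_eq_fderiv {z : ℝ × EuclideanSpace ℝ (Fin n)} (hz : z ∈ openSlab n T) :
    velocity T u z.1 z.2 = fderiv ℝ (Function.uncurry u) z (1, 0) := by
  rw [velocity, fderivWithin_of_mem_nhds (slab_mem_nhds hz)]

omit hT in
theorem contDiffOn_velocity :
    ContDiffOn ℝ 1 (Function.uncurry (velocity T u)) (openSlab n T) :=
  ((contDiffOn_fderiv_openSlab hu).clm_apply contDiffOn_const).congr
    fun _ hz => velocity_eq_fderiv hz

omit hT in
theorem contDiff_velocity_slice {t : ℝ} (h1 : 1 < t) (ht : (t : EReal) < T) :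
    ContDiff ℝ 1 (velocity T u t) := by
  rw [← contDiffOn_univ]
  exact (contDiffOn_velocity hu).comp (f := fun x => (t, x)) (by fun_prop) (fun x _ => ⟨h1, ht⟩)

omit hT in
theorem hasDerivAt_velocity {t : ℝ} (h1 : 1 < t) (ht : (t : EReal) < T)
    (x : EuclideanSpace ℝ (Fin n)) :
    HasDerivAt (fun s => velocity T u s x)
      (fderiv ℝ (Function.uncurry (velocity T u)) (t, x) (1, 0)) t := by
  have hz : (t, x) ∈ openSlab n T := ⟨h1, ht⟩
  have h := ((contDiffOn_velocity hu).differentiableOn (by norm_num) (t, x) hz).differentiableAt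
    (isOpen_openSlab.mem_nhds hz) |>.hasFDerivAt
  exact h.comp_hasDerivAt (f := fun s => (s, x)) t
    ((hasDerivAt_id t).prodMk (hasDerivAt_const t x))

omit hT in
theorem deriv_deriv_eq {t : ℝ} (h1 : 1 < t) (ht : (t : EReal) < T)
    (x : EuclideanSpace ℝ (Fin n)) :
    deriv (deriv (fun s => u s x)) t
      = fderiv ℝ (Function.uncurry (velocity T u)) (t, x) (1, 0) := by
  rw [← (hasDerivAt_velocity hu h1 ht x).deriv]
  apply EventuallyEq.deriv_eq
  have : {s : ℝ | (s : EReal) < T} ∈ 𝓝 t :=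
    (isOpen_lt continuous_coe_real_ereal continuous_const).mem_nhds ht
  filter_upwards [this, Ioi_mem_nhds h1] with s h3 h4
  exact (hasDerivAt_time hu h4 h3 x).deriv

omit hT in
theorem continuousOn_deriv_velocity :
    ContinuousOn (fun z => fderiv ℝ (Function.uncurry (velocity T u)) z (1, 0)) (openSlab n T) :=
  ((contDiffOn_velocity hu).continuousOn_fderiv_of_isOpen isOpen_openSlab le_rfl).clm_apply
    continuousOn_const

omit hT in
theorem hasFDerivAt_velocity_slice {t : ℝ} (h1 : 1 < t) (ht : (t : EReal) < T)
    (x : EuclideanSpace ℝ (Fin n)) :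
    HasFDerivAt (velocity T u t) ((fderiv ℝ (Function.uncurry (velocity T u)) (t, x)).comp
      (ContinuousLinearMap.inr ℝ ℝ (EuclideanSpace ℝ (Fin n)))) x := by
  have hz : (t, x) ∈ openSlab n T := ⟨h1, ht⟩
  have h := ((contDiffOn_velocity hu).differentiableOn (by norm_num) (t, x) hz).differentiableAt
    (isOpen_openSlab.mem_nhds hz) |>.hasFDerivAt
  exact h.comp (f := fun y => (t, y)) x (hasFDerivAt_prodMk_right t x)

omit hT in
theorem continuousOn_gradient_velocity :
    ContinuousOn (Function.uncurry fun t => ∇ (velocity T u t)) (openSlab n T) := by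
  have : ContinuousOn (fun z => (InnerProductSpace.toDual ℝ _).symm
      ((fderiv ℝ (Function.uncurry (velocity T u)) z).comp
      (ContinuousLinearMap.inr ℝ ℝ (EuclideanSpace ℝ (Fin n))))) (openSlab n T) :=
    (InnerProductSpace.toDual ℝ _).symm.continuous.comp_continuousOn
      (((contDiffOn_velocity hu).continuousOn_fderiv_of_isOpen isOpen_openSlab le_rfl).clm_comp
        continuousOn_const)
  refine this.congr fun z hz => ?_
  show ∇ (velocity T u z.1) z.2 = _
  rw [gradient, (hasFDerivAt_velocity_slice hu hz.1 hz.2 z.2).fderiv]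

omit hT in
-- Symmetry of the second derivative at interior points lets time derivative and gradient commute.
-- The energy density contains |∇u|², and this is how it is differentiated in time.
theorem hasDerivAt_gradient {t : ℝ} (h1 : 1 < t) (ht : (t : EReal) < T)
    (x : EuclideanSpace ℝ (Fin n)) :
    HasDerivAt (fun s => ∇ (u s) x) (∇ (velocity T u t) x) t := by
  have hz : (t, x) ∈ openSlab n T := ⟨h1, ht⟩
  have hn := isOpen_openSlab.mem_nhds hz
  have hD := (((contDiffOn_fderiv_openSlab hu).differentiableOn (by norm_num)) (t, x)
    hz).differentiableAt hn |>.hasFDerivAt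
  have hDt := hD.comp_hasDerivAt (f := fun s => (s, x)) t
    ((hasDerivAt_id t).prodMk (hasDerivAt_const t x))
  have hsymm : IsSymmSndFDerivAt ℝ (Function.uncurry u) (t, x) :=
    (hu.contDiffAt (slab_mem_nhds hz)).isSymmSndFDerivAt (by simp)
  have hv : fderiv ℝ (velocity T u t) x
      = (fderiv ℝ (fderiv ℝ (Function.uncurry u)) (t, x) (1, 0)).comp
        (ContinuousLinearMap.inr ℝ ℝ (EuclideanSpace ℝ (Fin n))) := by
    rw [(hasFDerivAt_velocity_slice hu h1 ht x).fderiv]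
    have e : Function.uncurry (velocity T u) =ᶠ[𝓝 (t, x)]
        fun z => fderiv ℝ (Function.uncurry u) z (1, 0) := by
      filter_upwards [hn] with z hz
      exact velocity_eq_fderiv hz
    rw [e.fderiv_eq, fderiv_clm_apply hD.differentiableAt (differentiableAt_const _)]
    ext v
    simp
    exact hsymm _ _
  have hG := ((InnerProductSpace.toDual ℝ (EuclideanSpace ℝ (Fin n))).symm.toContinuousLinearEquiv
    |>.toContinuousLinearMap.hasFDerivAt.comp_hasDerivAt t
      (((ContinuousLinearMap.compL ℝ (EuclideanSpace ℝ (Fin n))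
        (ℝ × EuclideanSpace ℝ (Fin n)) ℝ).flip
        (ContinuousLinearMap.inr ℝ ℝ (EuclideanSpace ℝ (Fin n)))).hasFDerivAt.comp_hasDerivAt t hDt))
  rw [gradient, hv]
  refine HasDerivAt.congr_of_eventuallyEq hG ?_
  have : {s : ℝ | (s : EReal) < T} ∈ 𝓝 t :=
    (isOpen_lt continuous_coe_real_ereal continuous_const).mem_nhds ht
  filter_upwards [this, Ioi_mem_nhds h1] with s h3 h4
  rw [gradient_slice hu (le_of_lt h4) h3,
    fderivWithin_of_mem_nhds (slab_mem_nhds (z := (s, x)) ⟨h4, h3⟩)]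
  rfl

end Regularity

end

/-! ### Finite speed of propagation -/

section

/-- The distance travelled by light, `∫₁ᵗ s^(-α) ds`. -/
noncomputable def lightRadius (α t : ℝ) : ℝ := (t ^ (1 - α) - 1) / (1 - α)

theorem lightRadius_one (α : ℝ) : lightRadius α 1 = 0 := by simp [lightRadius]

theorem hasDerivAt_lightRadius {α t : ℝ} (hα : α < 1) (ht : 0 < t) :
    HasDerivAt (lightRadius α) (t ^ (-α)) t := by
  have h := ((Real.hasDerivAt_rpow_const (p := 1 - α) (Or.inl ht.ne')).sub_const 1).div_const
    (1 - α)
  convert! h using 1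
  have : 1 - α ≠ 0 := by linarith
  rw [show 1 - α - 1 = -α by ring]
  field_simp

theorem lightRadius_mono {α s t : ℝ} (hα : α < 1) (hs : 0 ≤ s) (hst : s ≤ t) :
    lightRadius α s ≤ lightRadius α t := by
  have : 0 < 1 - α := by linarith
  unfold lightRadius
  gcongr

theorem lightRadius_nonneg {α t : ℝ} (hα : α < 1) (ht : 1 ≤ t) : 0 ≤ lightRadius α t := by
  rw [← lightRadius_one α]
  exact lightRadius_mono hα zero_le_one ht

/-- The energy cutoff is the square of a positive part: unlike the positive part itself it is C¹, as
Green's identity requires of the test function. -/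
theorem hasDerivAt_max_zero_sq (s : ℝ) : HasDerivAt (fun s : ℝ => max s 0 ^ 2) (2 * max s 0) s := by
  rcases lt_trichotomy s 0 with h | h | h
  · rw [max_eq_right h.le, mul_zero]
    refine (hasDerivAt_const s (0 : ℝ)).congr_of_eventuallyEq ?_
    filter_upwards [Iio_mem_nhds h] with y hy
    rw [max_eq_right (le_of_lt hy)]; norm_num
  · subst h
    rw [max_self, mul_zero, hasDerivAt_iff_isLittleO_nhds_zero]
    simp only [zero_add, max_self, smul_zero, sub_zero]
    have h1 : (fun h : ℝ => max h 0 ^ 2 - 0 ^ 2) =O[𝓝 0] fun h : ℝ => h ^ 2 := by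
      refine Asymptotics.IsBigO.of_bound 1 (Eventually.of_forall fun y => ?_)
      rw [one_mul, Real.norm_of_nonneg (by simp), Real.norm_of_nonneg (sq_nonneg y)]
      rcases le_total y 0 with hy | hy
      · rw [max_eq_right hy]; nlinarith
      · rw [max_eq_left hy]; simp
    exact h1.trans_isLittleO (by simpa using (Asymptotics.isLittleO_pow_id (𝕜 := ℝ) one_lt_two))
  · rw [max_eq_left h.le]
    have h1 : HasDerivAt (fun s : ℝ => s ^ 2) (2 * s) s := by simpa using hasDerivAt_pow 2 s
    refine h1.congr_of_eventuallyEq ?_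
    filter_upwards [Ioi_mem_nhds h] with y hy
    rw [max_eq_left (le_of_lt hy)]

theorem contDiff_max_zero_sq : ContDiff ℝ 1 (fun s : ℝ => max s 0 ^ 2) := by
  rw [contDiff_one_iff_deriv]
  refine ⟨fun s => (hasDerivAt_max_zero_sq s).differentiableAt, ?_⟩
  rw [show deriv (fun s : ℝ => max s 0 ^ 2) = fun s => 2 * max s 0 from
    funext fun s => (hasDerivAt_max_zero_sq s).deriv]
  fun_prop

section SmoothDist

variable {n : ℕ} (δ : ℝ) (x₀ : EuclideanSpace ℝ (Fin n))

/-- A smooth majorant of the distance to `x₀`. -/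
noncomputable def smoothDist (x : EuclideanSpace ℝ (Fin n)) : ℝ := √(δ ^ 2 + ‖x - x₀‖ ^ 2)

variable {δ}

theorem smoothDist_pos (hδ : 0 < δ) (x : EuclideanSpace ℝ (Fin n)) : 0 < smoothDist δ x₀ x :=
  Real.sqrt_pos.2 (by positivity)

theorem norm_sub_le_smoothDist (x : EuclideanSpace ℝ (Fin n)) : ‖x - x₀‖ ≤ smoothDist δ x₀ x :=
  Real.le_sqrt_of_sq_le (by nlinarith [sq_nonneg δ])

theorem smoothDist_self (hδ : 0 < δ) : smoothDist δ x₀ x₀ = δ := by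
  simp [smoothDist, Real.sqrt_sq hδ.le]

theorem contDiff_smoothDist (hδ : 0 < δ) : ContDiff ℝ 2 (smoothDist δ x₀) := by
  unfold smoothDist
  refine ContDiff.sqrt ?_ fun x => by positivity
  exact contDiff_const.add ((contDiff_id.sub contDiff_const).norm_sq ℝ)

/-- The gradient is (x - x₀) / `smoothDist`. The bound 1 means that a cutoff retreating at the
propagation speed t^(-α) compensates the flux created by its spatial gradient. -/
theorem norm_gradient_smoothDist_le (hδ : 0 < δ) (x : EuclideanSpace ℝ (Fin n)) :
    ‖∇ (smoothDist δ x₀) x‖ ≤ 1 := by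
  have hs := smoothDist_pos x₀ hδ x
  have h1 : HasFDerivAt (fun x => δ ^ 2 + ‖x - x₀‖ ^ 2) (2 • innerSL ℝ (x - x₀)) x := by
    have := (((hasFDerivAt_id x).sub_const x₀).norm_sq).const_add (δ ^ 2)
    convert! this using 1
  have h2 := h1.sqrt (by positivity)
  have e : fderiv ℝ (smoothDist δ x₀) x = _ := h2.fderiv
  rw [gradient, LinearIsometryEquiv.norm_map, e, norm_smul, two_nsmul, ← two_smul ℝ, norm_smul,
    innerSL_apply_norm, Real.norm_of_nonneg (by positivity), Real.norm_of_nonneg (by norm_num)]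
  have := norm_sub_le_smoothDist (δ := δ) x₀ x
  change 1 / (2 * smoothDist δ x₀ x) * (2 * ‖x - x₀‖) ≤ 1
  rw [show 1 / (2 * smoothDist δ x₀ x) * (2 * ‖x - x₀‖) = ‖x - x₀‖ / smoothDist δ x₀ x by
    field_simp]
  exact (div_le_one hs).2 this

end SmoothDist

/-- The pointwise inequality behind the energy estimate. -/
theorem energy_density_inequality {m τ a a₀ v g w M γ μt d N : ℝ} (hm : 0 ≤ m) (hτ : 0 ≤ τ)
    (ha : a = τ ^ 2) (ha₀ : 0 < a₀) (haa : a₀ ≤ a) (hM : 0 ≤ M) (hN : N ≤ M * g)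
    (hN0 : 0 ≤ N) (hμ : 0 ≤ μt) (hγ : γ ≤ 0) (hd : |d| ≤ g) :
    -2 * m * τ * ((v ^ 2 + a * g ^ 2 + w ^ 2) / 2) + 2 * a * m * v * d
      + m ^ 2 * (v * (N - μt * v) + γ * g ^ 2 + w * v)
      ≤ (M * (1 + 1 / a₀) + 1) * (m ^ 2 * ((v ^ 2 + a * g ^ 2 + w ^ 2) / 2)) := by
  have h1 : v * d ≤ |v| * g := by
    calc v * d ≤ |v * d| := le_abs_self _
      _ = |v| * |d| := abs_mul _ _
      _ ≤ |v| * g := by gcongr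
  -- Since a = τ², this is 2(τg)|v| ≤ v² + τ²g². The flux is thus absorbed by the loss term -2mτ
  -- times the density, leaving only -mτw² ≤ 0.
  have h2 : 2 * a * m * v * d ≤ m * τ * (v ^ 2 + a * g ^ 2) := by
    have e1 : 2 * a * m * v * d = m * τ * (2 * τ * (v * d)) := by rw [ha]; ring
    have e2 : 2 * τ * (v * d) ≤ v ^ 2 + a * g ^ 2 := by
      rw [ha]
      nlinarith [sq_nonneg (|v| - τ * g), sq_abs v]
    rw [e1]
    gcongr
  have h3 : v * N ≤ M * (1 + 1 / a₀) * ((v ^ 2 + a * g ^ 2 + w ^ 2) / 2) := by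
    have e1 : v * N ≤ |v| * (M * g) := by
      calc v * N ≤ |v| * N := by gcongr; exact le_abs_self v
        _ ≤ _ := by gcongr
    have e2 : |v| * g ≤ (v ^ 2 + g ^ 2) / 2 := by nlinarith [sq_nonneg (|v| - g), sq_abs v]
    have e3 : g ^ 2 ≤ 1 / a₀ * (a * g ^ 2) := by
      rw [one_div, ← div_eq_inv_mul, le_div_iff₀ ha₀]
      nlinarith [sq_nonneg g]
    have e4 : v ^ 2 + g ^ 2 ≤ (1 + 1 / a₀) * (v ^ 2 + a * g ^ 2 + w ^ 2) := by
      have : 0 ≤ 1 / a₀ * (v ^ 2 + w ^ 2) := by positivity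
      have : 0 ≤ a * g ^ 2 := mul_nonneg (ha₀.le.trans haa) (sq_nonneg _)
      nlinarith [sq_nonneg w]
    calc v * N ≤ |v| * (M * g) := e1
      _ = M * (|v| * g) := by ring
      _ ≤ M * (((1 + 1 / a₀) * (v ^ 2 + a * g ^ 2 + w ^ 2)) / 2) := by
        gcongr; linarith
      _ = _ := by ring
  have h4 : w * v ≤ (v ^ 2 + a * g ^ 2 + w ^ 2) / 2 := by
    have : 0 ≤ a * g ^ 2 := mul_nonneg (ha₀.le.trans haa) (sq_nonneg _)
    nlinarith [sq_nonneg (w - v)]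
  have h5 : v * (N - μt * v) + γ * g ^ 2 + w * v
      ≤ (M * (1 + 1 / a₀) + 1) * ((v ^ 2 + a * g ^ 2 + w ^ 2) / 2) := by
    nlinarith [mul_nonneg hμ (sq_nonneg v), mul_nonneg (neg_nonneg.2 hγ) (sq_nonneg g)]
  have h6 := mul_le_mul_of_nonneg_left h5 (sq_nonneg m)
  have h7 : 0 ≤ m * τ * w ^ 2 := by positivity
  nlinarith

variable {n : ℕ} {T : EReal} {u : ℝ → EuclideanSpace ℝ (Fin n) → ℝ} {α μ p ε R : ℝ}
  {u₀ u₁ : EuclideanSpace ℝ (Fin n) → ℝ}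

theorem IsClassicalSolution.contDiffOn_uncurry (h : IsClassicalSolution α μ p ε u₀ u₁ T u) :
    ContDiffOn ℝ 2 (Function.uncurry u) (slab n T) := h.contDiffOn

theorem IsClassicalSolution.deriv_velocity (h : IsClassicalSolution α μ p ε u₀ u₁ T u) {t : ℝ}
    (h1 : 1 < t) (ht : (t : EReal) < T) (x : EuclideanSpace ℝ (Fin n)) :
    fderiv ℝ (Function.uncurry (velocity T u)) (t, x) (1, 0)
      = 1 / t ^ (2 * α) * Laplacian.laplacian (u t) x - μ / t * velocity T u t x
        + ‖∇ (u t) x‖ ^ p := by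
  have e := h.equation t x h1 ht
  rw [deriv_deriv_eq h.contDiffOn_uncurry h1 ht,
    (hasDerivAt_time h.contDiffOn_uncurry h1 ht x).deriv] at e
  linarith

theorem nonpos_of_deriv_le_mul {a b C : ℝ} (hab : a ≤ b) {f f' : ℝ → ℝ}
    (hf : ContinuousOn f (Icc a b)) (hd : ∀ t ∈ Ioo a b, HasDerivAt f (f' t) t) (h0 : f a ≤ 0)
    (hC : ∀ t ∈ Ioo a b, f' t ≤ C * f t) : f b ≤ 0 := by
  have hanti : AntitoneOn (fun t => Real.exp (-C * t) * f t) (Icc a b) := by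
    apply antitoneOn_of_hasDerivWithinAt_nonpos (convex_Icc a b)
      (f' := fun t => Real.exp (-C * t) * (-C) * f t + Real.exp (-C * t) * f' t)
    · exact ContinuousOn.mul (by fun_prop) hf
    · intro t ht
      rw [interior_Icc] at ht
      have h1 : HasDerivAt (fun t => Real.exp (-C * t)) (Real.exp (-C * t) * (-C)) t := by
        simpa using ((hasDerivAt_id t).const_mul (-C)).exp
      exact (h1.mul (hd t ht)).hasDerivWithinAt
    · intro t ht
      rw [interior_Icc] at ht
      have := hC t ht
      have he := Real.exp_pos (-C * t)
      nlinarith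
  have := hanti (left_mem_Icc.2 hab) (right_mem_Icc.2 hab) hab
  have h1 : Real.exp (-C * a) * f a ≤ 0 := mul_nonpos_of_nonneg_of_nonpos (Real.exp_pos _).le h0
  exact nonpos_of_mul_nonpos_right (this.trans h1) (Real.exp_pos _)

/-- Finite speed of propagation. -/
theorem IsClassicalSolution.eq_zero_of_lt_norm (h : IsClassicalSolution α μ p ε u₀ u₁ T u)
    (hα₀ : 0 ≤ α) (hα₁ : α < 1) (hμ : 0 ≤ μ) (hp : 1 < p)
    (hu₀ : tsupport u₀ ⊆ Metric.closedBall 0 R) (hu₁ : tsupport u₁ ⊆ Metric.closedBall 0 R)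
    {t₀ : ℝ} (h1 : 1 ≤ t₀) (ht₀ : (t₀ : EReal) < T) {x₀ : EuclideanSpace ℝ (Fin n)}
    (hx₀ : lightRadius α t₀ + R < ‖x₀‖) : u t₀ x₀ = 0 := by
  have hu := h.contDiffOn_uncurry
  have hT := h.one_lt
  -- `smoothDist` equals δ at its centre, so this gap keeps the cutoff positive at (t₀, x₀).
  obtain ⟨δ, hδ, hδ2⟩ : ∃ δ, 0 < δ ∧ δ < ‖x₀‖ - R - lightRadius α t₀ :=
    exists_between (by linarith)
  set ρ : ℝ := ‖x₀‖ - R with hρ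
  set K : Set (EuclideanSpace ℝ (Fin n)) := Metric.closedBall x₀ ρ with hK
  have hKc : IsCompact K := isCompact_closedBall x₀ ρ
  have hI : ∀ t ∈ Ioo 1 t₀, (t : EReal) < T := fun t ht =>
    lt_trans (by exact_mod_cast ht.2) ht₀
  have hIc : ∀ t ∈ Icc 1 t₀, (t : EReal) < T := fun t ht =>
    lt_of_le_of_lt (by exact_mod_cast ht.2) ht₀
  have hsub : Icc 1 t₀ ×ˢ univ ⊆ slab n T := fun z hz => ⟨hz.1.1, hIc _ hz.1⟩
  have hsubo : Ioo 1 t₀ ×ˢ univ ⊆ openSlab n T := fun z hz => ⟨hz.1.1, hI _ hz.1⟩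
  let d : EuclideanSpace ℝ (Fin n) → ℝ := smoothDist δ x₀
  have hdC : ContDiff ℝ 2 d := contDiff_smoothDist x₀ hδ
  -- A cutoff to a backward light cone. At time 1 it lives where |x - x₀| < ρ, hence |x| > R, where
  -- the data vanish.
  let m : ℝ → EuclideanSpace ℝ (Fin n) → ℝ := fun t x => max (ρ - lightRadius α t - d x) 0
  have hm0 : ∀ t x, 0 ≤ m t x := fun t x => le_max_right _ _
  let V := velocity T u
  -- The term u² is included so that vanishing energy gives u = 0 directly.
  let e : ℝ → EuclideanSpace ℝ (Fin n) → ℝ := fun t x =>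
    (V t x ^ 2 + 1 / t ^ (2 * α) * ‖∇ (u t) x‖ ^ 2 + u t x ^ 2) / 2
  have he0 : ∀ t, 0 < t → ∀ x, 0 ≤ e t x := fun t ht x => by positivity
  let Vt : ℝ → EuclideanSpace ℝ (Fin n) → ℝ := fun t x =>
    fderiv ℝ (Function.uncurry (velocity T u)) (t, x) (1, 0)
  let f : ℝ → EuclideanSpace ℝ (Fin n) → ℝ := fun t x => m t x ^ 2 * e t x
  let f' : ℝ → EuclideanSpace ℝ (Fin n) → ℝ := fun t x =>
    -2 * m t x * t ^ (-α) * e t x + m t x ^ 2 * (V t x * Vt t x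
      + -α * t ^ (-(2 * α) - 1) * ‖∇ (u t) x‖ ^ 2
      + 1 / t ^ (2 * α) * ⟪∇ (u t) x, ∇ (V t) x⟫_ℝ + u t x * V t x)
  have hmK : ∀ t, 1 ≤ t → ∀ x, x ∉ K → m t x = 0 := by
    intro t ht x hx
    refine max_eq_right ?_
    rw [hK, Metric.mem_closedBall, dist_eq_norm, not_le] at hx
    have := norm_sub_le_smoothDist (δ := δ) x₀ x
    have := lightRadius_nonneg hα₁ ht
    simp only [d]
    linarith
  have hfK : ∀ t, 1 ≤ t → ∀ x, x ∉ K → f t x = 0 := fun t ht x hx => by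
    simp [f, hmK t ht x hx]
  have hf'K : ∀ t, 1 ≤ t → ∀ x, x ∉ K → f' t x = 0 := fun t ht x hx => by
    simp [f', hmK t ht x hx]
  have cpow : ∀ q : ℝ, ContinuousOn (fun z : ℝ × EuclideanSpace ℝ (Fin n) => z.1 ^ q)
      (Icc 1 t₀ ×ˢ univ) := fun q =>
    continuousOn_fst.rpow_const fun z hz => Or.inl (zero_lt_one.trans_le hz.1.1).ne'
  have cm : ContinuousOn (Function.uncurry m) (Icc 1 t₀ ×ˢ univ) := by
    have c1 : ContinuousOn (fun z : ℝ × EuclideanSpace ℝ (Fin n) => lightRadius α z.1)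
        (Icc 1 t₀ ×ˢ univ) := ((cpow (1 - α)).sub continuousOn_const).div_const _
    have c2 : ContinuousOn (fun z : ℝ × EuclideanSpace ℝ (Fin n) => d z.2) (Icc 1 t₀ ×ˢ univ) :=
      (hdC.continuous.comp continuous_snd).continuousOn
    exact ((continuousOn_const.sub c1).sub c2).sup continuousOn_const
  have ca : ContinuousOn (fun z : ℝ × EuclideanSpace ℝ (Fin n) => 1 / z.1 ^ (2 * α))
      (Icc 1 t₀ ×ˢ univ) := continuousOn_const.div (cpow (2 * α))
        fun z hz => (Real.rpow_pos_of_pos (zero_lt_one.trans_le hz.1.1) _).ne'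
  have cV : ContinuousOn (Function.uncurry V) (Icc 1 t₀ ×ˢ univ) :=
    (continuousOn_velocity hT hu).mono hsub
  have cG : ContinuousOn (Function.uncurry fun t => ∇ (u t)) (Icc 1 t₀ ×ˢ univ) :=
    (continuousOn_gradient_slice hT hu).mono hsub
  have cU : ContinuousOn (Function.uncurry u) (Icc 1 t₀ ×ˢ univ) := hu.continuousOn.mono hsub
  have ce : ContinuousOn (Function.uncurry e) (Icc 1 t₀ ×ˢ univ) :=
    (((cV.pow 2).add (ca.mul (cG.norm.pow 2))).add (cU.pow 2)).div_const 2
  have cf : ContinuousOn (Function.uncurry f) (Icc 1 t₀ ×ˢ univ) := (cm.pow 2).mul ce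
  have hoc : Ioo 1 t₀ ×ˢ (univ : Set (EuclideanSpace ℝ (Fin n))) ⊆ Icc 1 t₀ ×ˢ univ :=
    prod_mono Ioo_subset_Icc_self le_rfl
  have cVt : ContinuousOn (Function.uncurry Vt) (Ioo 1 t₀ ×ˢ univ) :=
    (continuousOn_deriv_velocity hu).mono hsubo
  have cGV : ContinuousOn (Function.uncurry fun t => ∇ (V t)) (Ioo 1 t₀ ×ˢ univ) :=
    (continuousOn_gradient_velocity hu).mono hsubo
  have cf' : ContinuousOn (Function.uncurry f') (Ioo 1 t₀ ×ˢ univ) := by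
    have q1 := (continuousOn_const (c := (-2 : ℝ)).mul (cm.mono hoc)).mul ((cpow (-α)).mono hoc)
    have q2 := q1.mul (ce.mono hoc)
    have q3 := ((cV.mono hoc).mul cVt).add ((continuousOn_const (c := -α).mul
      ((cpow (-(2 * α) - 1)).mono hoc)).mul ((cG.mono hoc).norm.pow 2))
    have q4 := (q3.add ((ca.mono hoc).mul ((cG.mono hoc).inner (𝕜 := ℝ) cGV))).add
      ((cU.mono hoc).mul (cV.mono hoc))
    exact q2.add (((cm.mono hoc).pow 2).mul q4)
  have hfd : ∀ t ∈ Ioo 1 t₀, ∀ x, HasDerivAt (fun s => f s x) (f' t x) t := by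
    intro t ht x
    have t0 : 0 < t := zero_lt_one.trans ht.1
    have d1 : HasDerivAt (fun s => m s x ^ 2) (2 * m t x * (-(t ^ (-α)))) t := by
      have q := (hasDerivAt_max_zero_sq (ρ - lightRadius α t - d x)).comp t
        (((hasDerivAt_lightRadius hα₁ t0).const_sub ρ).sub_const (d x))
      exact q
    have d2 := hasDerivAt_velocity hu ht.1 (hI t ht) x
    have d3 : HasDerivAt (fun s : ℝ => 1 / s ^ (2 * α)) (-(2 * α) * t ^ (-(2 * α) - 1)) t := by
      refine (Real.hasDerivAt_rpow_const (p := -(2 * α)) (Or.inl t0.ne')).congr_of_eventuallyEq ?_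
      filter_upwards [Ioi_mem_nhds t0] with s hs
      rw [Real.rpow_neg (le_of_lt hs), one_div]
    have d4 := (hasDerivAt_gradient hu ht.1 (hI t ht) x).norm_sq
    have d5 := hasDerivAt_time hu ht.1 (hI t ht) x
    have d6 := d1.mul ((((d2.pow 2).add (d3.mul d4)).add (d5.pow 2)).div_const 2)
    convert! d6 using 1
    simp only [f', e, Vt, V, Pi.add_apply, Pi.mul_apply, Pi.pow_apply]
    push_cast
    ring
  -- The gradient is bounded by some B on the compact set [1, t₀] × K, so |∇u|^p ≤ |B|^(p-1) |∇u|
  -- there and the nonlinearity enters a Grönwall estimate as a linear term.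
  have hmain : ∃ C : ℝ, ∀ t ∈ Ioo 1 t₀, ∫ x, f' t x ≤ C * ∫ x, f t x := by
    obtain ⟨B, hB⟩ := (isCompact_Icc.prod hKc).exists_bound_of_continuousOn
      (f := fun z => ∇ (u z.1) z.2) (cG.mono (prod_mono le_rfl (subset_univ K)))
    set a₀ : ℝ := 1 / t₀ ^ (2 * α) with ha₀
    have ha₀p : 0 < a₀ := by
      have := Real.rpow_pos_of_pos (zero_lt_one.trans_le h1) (2 * α)
      positivity
    refine ⟨|B| ^ (p - 1) * (1 + 1 / a₀) + 1, fun t ht => ?_⟩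
    have t0 : 0 < t := zero_lt_one.trans ht.1
    have htI := Ioo_subset_Icc_self ht
    have slice : ∀ {g : ℝ → EuclideanSpace ℝ (Fin n) → ℝ},
        ContinuousOn (Function.uncurry g) (Ioo 1 t₀ ×ˢ univ) → Continuous (g t) := by
      intro g hg
      rw [← continuousOn_univ]
      exact hg.comp (f := fun x => (t, x)) (by fun_prop) (fun x _ => ⟨ht, mem_univ _⟩)
    let ψ : EuclideanSpace ℝ (Fin n) → ℝ := fun x => m t x ^ 2 * V t x
    have hV1 : ContDiff ℝ 1 (V t) := contDiff_velocity_slice hu ht.1 (hI t ht)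
    have hu2 : ContDiff ℝ 2 (u t) := contDiff_slice hu ht.1.le (hI t ht)
    have hmm : ContDiff ℝ 1 (fun x => m t x ^ 2) :=
      contDiff_max_zero_sq.comp (contDiff_const.sub (hdC.of_le (by norm_num)))
    have hψ : ContDiff ℝ 1 ψ := hmm.mul hV1
    have hψs : HasCompactSupport ψ := HasCompactSupport.intro hKc fun x hx => by
      simp [ψ, hmK t ht.1.le x hx]
    have hψg : ∀ x, ∇ ψ x = m t x ^ 2 • ∇ (V t) x - (2 * m t x * V t x) • ∇ d x := by
      intro x
      have g1 : HasFDerivAt (fun x => m t x ^ 2) ((2 * m t x) • (-fderiv ℝ d x)) x := by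
        have q := (hasDerivAt_max_zero_sq (ρ - lightRadius α t - d x)).comp_hasFDerivAt x
          ((hdC.differentiable (by norm_num) x).hasFDerivAt.const_sub (ρ - lightRadius α t))
        exact q
      have g2 := g1.mul (hV1.differentiable one_ne_zero x).hasFDerivAt
      have g3 : fderiv ℝ ψ x = _ := g2.fderiv
      simp only [gradient, g3, map_add, map_smul, map_neg]
      module
    have green := integral_mul_laplacian_eq_neg hψ hu2 hψs
    have ci : Continuous fun x => ⟪∇ ψ x, ∇ (u t) x⟫_ℝ :=
      (continuous_gradient hψ).inner (continuous_gradient (hu2.of_le (by norm_num)))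
    have si : HasCompactSupport fun x => ⟪∇ ψ x, ∇ (u t) x⟫_ℝ := by
      refine HasCompactSupport.intro hψs fun x hx => ?_
      have : ψ =ᶠ[𝓝 x] fun _ => 0 := notMem_tsupport_iff_eventuallyEq.1 hx
      simp [this.gradient_eq]
    have i1 : Integrable fun x => ψ x * Laplacian.laplacian (u t) x :=
      (hψ.continuous.mul (continuous_laplacian hu2)).integrable_of_hasCompactSupport hψs.mul_right
    have i2 : Integrable fun x => ⟪∇ ψ x, ∇ (u t) x⟫_ℝ := ci.integrable_of_hasCompactSupport si
    have i12 : Integrable fun x => 1 / t ^ (2 * α) * (ψ x * Laplacian.laplacian (u t) x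
        + ⟪∇ ψ x, ∇ (u t) x⟫_ℝ) := (i1.add i2).const_mul _
    have i3 : Integrable (f' t) := (slice cf').integrable_of_hasCompactSupport
      (HasCompactSupport.intro hKc fun x hx => hf'K t ht.1.le x hx)
    have i4 : Integrable (f t) := (slice (cf.mono hoc)).integrable_of_hasCompactSupport
      (HasCompactSupport.intro hKc fun x hx => hfK t ht.1.le x hx)
    have hzero : ∫ x, 1 / t ^ (2 * α) * (ψ x * Laplacian.laplacian (u t) x
        + ⟪∇ ψ x, ∇ (u t) x⟫_ℝ) = 0 := by
      rw [integral_const_mul, integral_add i1 i2, green]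
      simp
    -- Subtracting Green's identity for ψ = m²V, whose integral is zero, cancels Δu and ∇V and
    -- leaves only the cutoff term 2amV⟨∇d, ∇u⟩. The energy inequality can then be checked
    -- pointwise.
    have hsplit : ∫ x, f' t x = ∫ x, (f' t x - 1 / t ^ (2 * α) *
        (ψ x * Laplacian.laplacian (u t) x + ⟪∇ ψ x, ∇ (u t) x⟫_ℝ)) := by
      rw [integral_sub i3 i12, hzero, sub_zero]
    rw [hsplit, ← integral_const_mul]
    refine integral_mono (i3.sub i12) (i4.const_mul _) fun x => ?_
    by_cases hx : x ∈ K
    · have hg : ‖∇ (u t) x‖ ≤ |B| := (hB (t, x) ⟨htI, hx⟩).trans (le_abs_self B)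
      have hin : |⟪∇ d x, ∇ (u t) x⟫_ℝ| ≤ ‖∇ (u t) x‖ := by
        refine (abs_real_inner_le_norm _ _).trans ?_
        exact mul_le_of_le_one_left (norm_nonneg _) (norm_gradient_smoothDist_le x₀ hδ x)
      have hpow : ‖∇ (u t) x‖ ^ p ≤ |B| ^ (p - 1) * ‖∇ (u t) x‖ := by
        rcases (norm_nonneg (∇ (u t) x)).eq_or_lt with h0 | h0
        · rw [← h0, Real.zero_rpow (by linarith), mul_zero]
        · rw [show p = (p - 1) + 1 by ring, Real.rpow_add_one h0.ne', add_sub_cancel_right]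
          gcongr
      have key := energy_density_inequality (m := m t x) (τ := t ^ (-α)) (a := 1 / t ^ (2 * α))
        (a₀ := a₀) (v := V t x) (g := ‖∇ (u t) x‖) (w := u t x) (M := |B| ^ (p - 1))
        (γ := -α * t ^ (-(2 * α) - 1)) (μt := μ / t) (d := ⟪∇ d x, ∇ (u t) x⟫_ℝ)
        (N := ‖∇ (u t) x‖ ^ p) (hm0 t x) (by positivity)
        (by rw [one_div, ← Real.rpow_neg t0.le, ← Real.rpow_natCast, ← Real.rpow_mul t0.le]
            congr 1; push_cast; ring)
        ha₀p (one_div_le_one_div_of_le (Real.rpow_pos_of_pos t0 _)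
          (Real.rpow_le_rpow t0.le ht.2.le (by linarith))) (by positivity) hpow
        (by positivity) (by positivity)
        (by have := Real.rpow_pos_of_pos t0 (-(2 * α) - 1); nlinarith) hin
      refine le_trans (le_of_eq ?_) key
      have hVt : Vt t x = _ := h.deriv_velocity ht.1 (hI t ht) x
      simp only [f', ψ, hψg, hVt, e, V, inner_sub_left, inner_smul_left]
      rw [real_inner_comm (∇ (velocity T u t) x)]
      simp only [RCLike.conj_to_real]
      ring
    · have e1 := hf'K t ht.1.le x hx
      have e2 := hfK t ht.1.le x hx
      have e3 : ψ x = 0 := by simp [ψ, hmK t ht.1.le x hx]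
      have e4 : ∇ ψ x = 0 := by simp [hψg, hmK t ht.1.le x hx]
      simp [e1, e2, e3, e4]
  obtain ⟨C, hC⟩ := hmain
  have hf1 : ∀ x, f 1 x = 0 := by
    intro x
    by_cases hx : m 1 x = 0
    · simp [f, hx]
    · have hlt : 0 < ρ - lightRadius α 1 - d x := by
        by_contra hc
        exact hx (max_eq_right (not_lt.1 hc))
      rw [lightRadius_one, sub_zero] at hlt
      have h3 : ‖x - x₀‖ < ρ := (norm_sub_le_smoothDist (δ := δ) x₀ x).trans_lt (by linarith)
      have h4 : R < ‖x‖ := by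
        have := norm_sub_norm_le x₀ x
        rw [norm_sub_rev] at this
        linarith
      have h5 : x ∉ Metric.closedBall (0 : EuclideanSpace ℝ (Fin n)) R := by simpa using h4
      have q0 : u 1 =ᶠ[𝓝 x] fun _ => 0 := by
        filter_upwards [notMem_tsupport_iff_eventuallyEq.1 fun hh => h5 (hu₀ hh)] with y hy
        rw [h.initial, hy]; simp
      have q1 : V 1 x = 0 := by
        simp only [V]
        rw [velocity_one hT hu, h.initial_deriv,
          image_eq_zero_of_notMem_tsupport fun hh => h5 (hu₁ hh), mul_zero]
      simp [f, e, q0.eq_of_nhds, q1, q0.gradient_eq]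
  have hEc : ContinuousOn (fun t => ∫ x, f t x) (Icc 1 t₀) :=
    continuousOn_integral_of_compact_support hKc cf (fun t x ht hx => hfK t ht.1 x hx)
  have hE := nonpos_of_deriv_le_mul h1 hEc (fun t ht => hasDerivAt_integral_of_isCompact hKc
    (cf.mono hoc) cf' hfd (fun t ht => hfK t ht.1.le) (fun t ht => hf'K t ht.1.le) ht)
    (by simp [hf1]) hC
  have hcf : Continuous (f t₀) := by
    rw [← continuousOn_univ]
    exact cf.comp (f := fun x => (t₀, x)) (by fun_prop)
      (fun x _ => ⟨right_mem_Icc.2 h1, mem_univ _⟩)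
  have hf0 : ∀ x, 0 ≤ f t₀ x := fun x =>
    mul_nonneg (sq_nonneg _) (he0 t₀ (zero_lt_one.trans_le h1) x)
  have hfx : f t₀ x₀ = 0 := by
    by_contra hne
    have := hcf.integral_pos_of_hasCompactSupport_nonneg_nonzero
      (μ := (volume : Measure (EuclideanSpace ℝ (Fin n))))
      (HasCompactSupport.intro hKc fun x hx => hfK t₀ h1 x hx) hf0 hne
    linarith
  have hmx : 0 < m t₀ x₀ := by
    refine lt_max_of_lt_left ?_
    simp only [d, smoothDist_self x₀ hδ]
    linarith
  have hex : e t₀ x₀ = 0 := (mul_eq_zero.1 hfx).resolve_left (by positivity)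
  have t0 : 0 < t₀ := zero_lt_one.trans_le h1
  have hp1 : 0 ≤ 1 / t₀ ^ (2 * α) * ‖∇ (u t₀) x₀‖ ^ 2 := by positivity
  have : u t₀ x₀ ^ 2 ≤ 0 := by
    simp only [e] at hex
    nlinarith [sq_nonneg (V t₀ x₀)]
  exact pow_eq_zero_iff two_ne_zero |>.1 (le_antisymm this (sq_nonneg _))

end

/-! ### Exponential moments, and integral inequalities on the light cone -/

section

variable {n : ℕ} {T : EReal} {u : ℝ → EuclideanSpace ℝ (Fin n) → ℝ} {α μ p ε R : ℝ}
  {u₀ u₁ : EuclideanSpace ℝ (Fin n) → ℝ}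

/-- All the values of `u` sit in the light cone over the ball of radius `R`. -/
def SupportedInCone (α R : ℝ) (T : EReal) (u : ℝ → EuclideanSpace ℝ (Fin n) → ℝ) : Prop :=
  ∀ t : ℝ, 1 ≤ t → (t : EReal) < T → ∀ x, lightRadius α t + R < ‖x‖ → u t x = 0

theorem continuousOn_lightRadius (α : ℝ) : ContinuousOn (lightRadius α) (Ioi 0) :=
  ((continuousOn_id.rpow_const fun _ ht => Or.inl (ne_of_gt ht)).sub continuousOn_const).div_const _

theorem SupportedInCone.eventually_eq_zero (hs : SupportedInCone α R T u) {t : ℝ} (h1 : 1 ≤ t)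
    (ht : (t : EReal) < T) {x : EuclideanSpace ℝ (Fin n)} (hx : lightRadius α t + R < ‖x‖) :
    ∀ᶠ s in 𝓝 t, 1 ≤ s → u s x = 0 := by
  have h2 : {s : ℝ | (s : EReal) < T} ∈ 𝓝 t :=
    (isOpen_lt continuous_coe_real_ereal continuous_const).mem_nhds ht
  have h3 : ContinuousAt (lightRadius α) t :=
    (continuousOn_lightRadius α).continuousAt (Ioi_mem_nhds (by linarith))
  filter_upwards [h2, h3.eventually_lt (g := fun _ => ‖x‖ - R) continuousAt_const (by linarith)]
    with s h4 h5 h6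
  exact hs s h6 h4 x (by linarith)

theorem SupportedInCone.velocity_eq_zero (hs : SupportedInCone α R T u) (hT : 1 < T)
    (hu : ContDiffOn ℝ 2 (Function.uncurry u) (slab n T)) {t : ℝ} (h1 : 1 ≤ t)
    (ht : (t : EReal) < T) {x : EuclideanSpace ℝ (Fin n)} (hx : lightRadius α t + R < ‖x‖) :
    velocity T u t x = 0 := by
  have hev := hs.eventually_eq_zero h1 ht hx
  rcases h1.eq_or_lt with rfl | h1'
  · rw [velocity_one hT hu]
    have e : (fun s => u s x) =ᶠ[𝓝[Ici 1] 1] fun _ => 0 := by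
      filter_upwards [mem_nhdsWithin_of_mem_nhds hev, self_mem_nhdsWithin] with s h2 h3
      exact h2 h3
    rw [e.derivWithin_eq (hs 1 le_rfl ht x hx)]
    simp
  · have e : (fun s => u s x) =ᶠ[𝓝 t] fun _ => 0 := by
      filter_upwards [hev, Ioi_mem_nhds h1'] with s h2 h3
      exact h2 (le_of_lt h3)
    exact (hasDerivAt_time hu h1' ht x).unique ((hasDerivAt_const t (0 : ℝ)).congr_of_eventuallyEq e)

theorem SupportedInCone.gradient_eq_zero (hs : SupportedInCone α R T u) {t : ℝ} (h1 : 1 ≤ t)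
    (ht : (t : EReal) < T) {x : EuclideanSpace ℝ (Fin n)} (hx : lightRadius α t + R < ‖x‖) :
    ∇ (u t) x = 0 := by
  have e : u t =ᶠ[𝓝 x] fun _ => 0 := by
    filter_upwards [(isOpen_lt continuous_const continuous_norm).mem_nhds hx] with y hy
    exact hs t h1 ht y hy
  simp [e.gradient_eq]

theorem SupportedInCone.hasCompactSupport (hs : SupportedInCone α R T u) {t : ℝ} (h1 : 1 ≤ t)
    (ht : (t : EReal) < T) : HasCompactSupport (u t) :=
  HasCompactSupport.intro (isCompact_closedBall 0 (lightRadius α t + R)) fun x hx =>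
    hs t h1 ht x (by simpa using hx)

theorem SupportedInCone.hasCompactSupport_gradient (hs : SupportedInCone α R T u) {t : ℝ}
    (h1 : 1 ≤ t) (ht : (t : EReal) < T) : HasCompactSupport (∇ (u t)) :=
  HasCompactSupport.intro (isCompact_closedBall 0 (lightRadius α t + R)) fun x hx =>
    hs.gradient_eq_zero h1 ht (by simpa using hx)

/-- The exponential moment `∫ u e^{⟨ξ, x⟩}`. -/
noncomputable def expMoment (u : ℝ → EuclideanSpace ℝ (Fin n) → ℝ) (ξ : EuclideanSpace ℝ (Fin n))
    (t : ℝ) : ℝ := ∫ x, u t x * Real.exp ⟪ξ, x⟫_ℝ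

/-- The second time derivative of the exponential moment, as given by the equation. -/
noncomputable def expMomentAccel (α μ p : ℝ) (T : EReal) (u : ℝ → EuclideanSpace ℝ (Fin n) → ℝ)
    (ξ : EuclideanSpace ℝ (Fin n)) (t : ℝ) : ℝ :=
  1 / t ^ (2 * α) * (‖ξ‖ ^ 2 * expMoment u ξ t) - μ / t * expMoment (velocity T u) ξ t
    + ∫ x, ‖∇ (u t) x‖ ^ p * Real.exp ⟪ξ, x⟫_ℝ

theorem contDiff_exp_inner (ξ : EuclideanSpace ℝ (Fin n)) {k : WithTop ℕ∞} :
    ContDiff ℝ k fun x => Real.exp ⟪ξ, x⟫_ℝ :=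
  (contDiff_const.inner ℝ contDiff_id).exp

theorem hasFDerivAt_exp_inner (ξ x : EuclideanSpace ℝ (Fin n)) :
    HasFDerivAt (fun x => Real.exp ⟪ξ, x⟫_ℝ) (Real.exp ⟪ξ, x⟫_ℝ • innerSL ℝ ξ) x :=
  (innerSL ℝ ξ).hasFDerivAt.exp

theorem gradient_exp_inner (ξ x : EuclideanSpace ℝ (Fin n)) :
    ∇ (fun x => Real.exp ⟪ξ, x⟫_ℝ) x = Real.exp ⟪ξ, x⟫_ℝ • ξ := by
  rw [gradient, (hasFDerivAt_exp_inner ξ x).fderiv, map_smul]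
  congr 1
  exact (InnerProductSpace.toDual ℝ _).symm_apply_apply ξ

/-- Integration by parts of the gradient against an exponential. -/
theorem integral_inner_gradient_exp {g : EuclideanSpace ℝ (Fin n) → ℝ} (hg : ContDiff ℝ 1 g)
    (hs : HasCompactSupport g) (ξ : EuclideanSpace ℝ (Fin n)) :
    ∫ x, ⟪ξ, ∇ g x⟫_ℝ * Real.exp ⟪ξ, x⟫_ℝ = -(‖ξ‖ ^ 2 * ∫ x, g x * Real.exp ⟪ξ, x⟫_ℝ) := by
  have h := integral_fderiv_mul_eq_neg hg (contDiff_exp_inner ξ) hs ξ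
  simp_rw [inner_gradient_right]
  simp only [RCLike.conj_to_real]
  rw [h, ← integral_const_mul]
  congr 2
  ext x
  rw [(hasFDerivAt_exp_inner ξ x).fderiv]
  simp only [smul_apply, innerSL_apply_apply, real_inner_self_eq_norm_sq,
    smul_eq_mul]
  ring

/-- The exponential is an eigenfunction of the Laplacian with eigenvalue ‖ξ‖²; this is why the
exponential moments obey an ordinary differential equation in time. -/
theorem integral_laplacian_exp {g : EuclideanSpace ℝ (Fin n) → ℝ} (hg : ContDiff ℝ 2 g)
    (hs : HasCompactSupport g) (ξ : EuclideanSpace ℝ (Fin n)) :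
    ∫ x, Laplacian.laplacian g x * Real.exp ⟪ξ, x⟫_ℝ
      = ‖ξ‖ ^ 2 * ∫ x, g x * Real.exp ⟪ξ, x⟫_ℝ := by
  have h := integral_mul_laplacian_eq_neg' (contDiff_exp_inner ξ) hg hs
  have h2 := integral_inner_gradient_exp (hg.of_le (by norm_num)) hs ξ
  simp_rw [gradient_exp_inner, inner_smul_left] at h
  simp only [RCLike.conj_to_real] at h
  simp_rw [mul_comm (Real.exp _)] at h
  rw [h, h2, neg_neg]

/-- Integration by parts in the direction ξ, then Cauchy–Schwarz. It trades u, whose sign is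
unknown, for the nonnegative |∇u|. -/
theorem le_integral_norm_gradient_exp {g : EuclideanSpace ℝ (Fin n) → ℝ} (hg : ContDiff ℝ 1 g)
    (hs : HasCompactSupport g) {ξ : EuclideanSpace ℝ (Fin n)} (hξ : 0 < ‖ξ‖) :
    ‖ξ‖ * ∫ x, g x * Real.exp ⟪ξ, x⟫_ℝ ≤ ∫ x, ‖∇ g x‖ * Real.exp ⟪ξ, x⟫_ℝ := by
  have h := integral_inner_gradient_exp hg hs ξ
  have hgc := continuous_gradient hg
  have hec : Continuous fun x : EuclideanSpace ℝ (Fin n) => Real.exp ⟪ξ, x⟫_ℝ :=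
    (contDiff_exp_inner ξ (k := 0)).continuous
  have hgs : HasCompactSupport (∇ g) :=
    (hs.fderiv (𝕜 := ℝ)).comp_left (g := (InnerProductSpace.toDual ℝ _).symm) (map_zero _)
  have i1 : Integrable fun x => ⟪ξ, ∇ g x⟫_ℝ * Real.exp ⟪ξ, x⟫_ℝ :=
    ((continuous_const.inner hgc).mul hec).integrable_of_hasCompactSupport
      (HasCompactSupport.mul_right (hgs.comp_left (g := fun v => ⟪ξ, v⟫_ℝ) (inner_zero_right _)))
  have i2 : Integrable fun x => ‖ξ‖ * (‖∇ g x‖ * Real.exp ⟪ξ, x⟫_ℝ) :=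
    ((hgc.norm.mul hec).integrable_of_hasCompactSupport
      (HasCompactSupport.mul_right (hgs.comp_left (g := fun v => ‖v‖) norm_zero))).const_mul _
  have h2 : ‖ξ‖ ^ 2 * ∫ x, g x * Real.exp ⟪ξ, x⟫_ℝ
      ≤ ‖ξ‖ * ∫ x, ‖∇ g x‖ * Real.exp ⟪ξ, x⟫_ℝ := by
    rw [← neg_neg (‖ξ‖ ^ 2 * _), ← h, ← integral_neg, ← integral_const_mul]
    refine integral_mono i1.neg i2 fun x => ?_
    have h3 : -⟪ξ, ∇ g x⟫_ℝ ≤ ‖ξ‖ * ‖∇ g x‖ :=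
      (neg_le_abs _).trans (abs_real_inner_le_norm _ _)
    have h4 := mul_le_mul_of_nonneg_right h3 (Real.exp_pos ⟪ξ, x⟫_ℝ).le
    simp only
    linarith
  rw [sq, mul_assoc] at h2
  exact le_of_mul_le_mul_left h2 hξ

/-- For a unit vector e, write 1 as the derivative of ⟨e, x⟩ along e and integrate by parts: the
linear weight is at most r in absolute value on the ball. -/
theorem integral_le_radius_mul_integral_norm_gradient (hn : 1 ≤ n) {r : ℝ}
    {g : EuclideanSpace ℝ (Fin n) → ℝ} (hg : ContDiff ℝ 1 g) (hs : ∀ x, r < ‖x‖ → g x = 0)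
    (hs' : ∀ x, r < ‖x‖ → ∇ g x = 0) : ∫ x, g x ≤ r * ∫ x, ‖∇ g x‖ := by
  have hgs : HasCompactSupport g := HasCompactSupport.intro (isCompact_closedBall 0 r)
    fun x hx => hs x (by simpa using hx)
  have hgs' : HasCompactSupport (∇ g) := HasCompactSupport.intro (isCompact_closedBall 0 r)
    fun x hx => hs' x (by simpa using hx)
  have hgc := continuous_gradient hg
  obtain ⟨e, he⟩ : ∃ e : EuclideanSpace ℝ (Fin n), ‖e‖ = 1 :=
    ⟨EuclideanSpace.single ⟨0, hn⟩ 1, by simp⟩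
  have hl : ContDiff ℝ 1 (innerSL ℝ e) := (innerSL ℝ e).contDiff
  have h := integral_mul_fderiv_eq_neg hg hl hgs e
  have h1 : ∀ x, fderiv ℝ (innerSL ℝ e) x e = 1 := by
    intro x
    rw [ContinuousLinearMap.fderiv]
    simp [he]
  simp_rw [h1, mul_one] at h
  rw [h, ← integral_neg, ← integral_const_mul]
  have i2 : Integrable fun x => r * ‖∇ g x‖ := (hgc.norm.integrable_of_hasCompactSupport
    (hgs'.comp_left (g := fun v => ‖v‖) norm_zero)).const_mul _
  have hfe : ∀ x, fderiv ℝ g x e = ⟪∇ g x, e⟫_ℝ := fun x => (inner_gradient_left ..).symm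
  have i1 : Integrable fun x => -(fderiv ℝ g x e * innerSL ℝ e x) := by
    simp_rw [hfe]
    refine Continuous.integrable_of_hasCompactSupport
      ((hgc.inner continuous_const).mul hl.continuous).neg (HasCompactSupport.intro hgs'
        fun x hx => ?_)
    rw [image_eq_zero_of_notMem_tsupport hx, inner_zero_left, zero_mul, neg_zero]
  refine integral_mono i1 i2 fun x => ?_
  simp only [hfe, innerSL_apply_apply]
  rcases le_or_gt ‖x‖ r with hx | hx
  · have q1 : |⟪∇ g x, e⟫_ℝ| ≤ ‖∇ g x‖ := by
      simpa [he] using abs_real_inner_le_norm (∇ g x) e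
    have q2 : |⟪e, x⟫_ℝ| ≤ r := by
      refine le_trans ?_ hx
      simpa [he] using abs_real_inner_le_norm e x
    calc -(⟪∇ g x, e⟫_ℝ * ⟪e, x⟫_ℝ) ≤ |⟪∇ g x, e⟫_ℝ * ⟪e, x⟫_ℝ| := neg_le_abs _
      _ = |⟪∇ g x, e⟫_ℝ| * |⟪e, x⟫_ℝ| := abs_mul _ _
      _ ≤ ‖∇ g x‖ * r := by gcongr
      _ = r * ‖∇ g x‖ := mul_comm _ _
  · simp [hs' x hx]

/-- Hölder's inequality against the indicator of the ball of radius r. -/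
theorem rpow_integral_le {r : ℝ} (hr : 0 ≤ r) (hp : 1 < p)
    {g : EuclideanSpace ℝ (Fin n) → ℝ} (hg : Continuous g) (hg0 : ∀ x, 0 ≤ g x)
    (hs : ∀ x, r < ‖x‖ → g x = 0) :
    (∫ x, g x) ^ p ≤ (r ^ n * (volume (Metric.ball (0 : EuclideanSpace ℝ (Fin n)) 1)).toReal)
      ^ (p - 1) * ∫ x, g x ^ p := by
  have hgs : HasCompactSupport g := HasCompactSupport.intro (isCompact_closedBall 0 r)
    fun x hx => hs x (by simpa using hx)
  set K := Metric.closedBall (0 : EuclideanSpace ℝ (Fin n)) r with hK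
  have hKm : MeasurableSet K := Metric.isClosed_closedBall.measurableSet
  have hKf : volume K ≠ ⊤ := (isCompact_closedBall _ _).measure_lt_top.ne
  have hvol : (volume K).toReal
      = r ^ n * (volume (Metric.ball (0 : EuclideanSpace ℝ (Fin n)) 1)).toReal := by
    rw [hK, Measure.addHaar_closedBall _ _ hr, ENNReal.toReal_mul, finrank_euclideanSpace_fin,
      ENNReal.toReal_ofReal (by positivity)]
  have hpq : p.HolderConjugate (p / (p - 1)) := Real.HolderConjugate.conjExponent hp
  have m1 : MemLp g (ENNReal.ofReal p) := hg.memLp_of_hasCompactSupport hgs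
  have m2 : MemLp (K.indicator fun _ => (1 : ℝ)) (ENNReal.ofReal (p / (p - 1))) :=
    memLp_indicator_const _ hKm _ (Or.inr hKf)
  have key := integral_mul_le_Lp_mul_Lq_of_nonneg hpq (Eventually.of_forall hg0)
    (Eventually.of_forall fun x => indicator_nonneg (fun _ _ => zero_le_one) x) m1 m2
  have e1 : ∀ x, g x * K.indicator (fun _ => (1 : ℝ)) x = g x := by
    intro x
    by_cases hx : x ∈ K
    · simp [hx]
    · rw [hs x (by simpa [hK] using hx), zero_mul]
  have e2 : ∀ x, K.indicator (fun _ => (1 : ℝ)) x ^ (p / (p - 1)) = K.indicator (fun _ => 1) x := by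
    intro x
    by_cases hx : x ∈ K
    · simp [hx]
    · simp only [hx, not_false_eq_true, indicator_of_notMem]
      exact Real.zero_rpow hpq.symm.ne_zero
  simp_rw [e1, e2] at key
  rw [integral_indicator hKm, setIntegral_const, smul_eq_mul, mul_one, Measure.real, hvol] at key
  have hp0 : 0 < p := by linarith
  set v := r ^ n * (volume (Metric.ball (0 : EuclideanSpace ℝ (Fin n)) 1)).toReal with hv
  have hv0 : 0 ≤ v := by positivity
  have hI : 0 ≤ ∫ x, g x ^ p := integral_nonneg fun x => Real.rpow_nonneg (hg0 x) _
  calc (∫ x, g x) ^ p ≤ ((∫ x, g x ^ p) ^ (1 / p) * v ^ (1 / (p / (p - 1)))) ^ p :=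
        Real.rpow_le_rpow (integral_nonneg hg0) key hp0.le
    _ = v ^ (p - 1) * ∫ x, g x ^ p := by
      rw [Real.mul_rpow (by positivity) (by positivity), ← Real.rpow_mul hI, ← Real.rpow_mul hv0]
      rw [one_div_mul_cancel hp0.ne', Real.rpow_one, mul_comm]
      congr 2
      field_simp

section Moments

variable (h : IsClassicalSolution α μ p ε u₀ u₁ T u) (hs : SupportedInCone α R T u) (hα₁ : α < 1)
include h hs hα₁

/-- Up to time b every slice is supported in one fixed ball, which justifies differentiating twice
under the integral. The equation then gives the second derivative, the Laplacian contributing the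
factor ‖ξ‖². The case ξ = 0 is the mean. -/
theorem expMoment_calculus (ξ : EuclideanSpace ℝ (Fin n)) (hp : 1 < p) {b : ℝ}
    (hb : (b : EReal) < T) :
    ContinuousOn (expMoment u ξ) (Icc 1 b) ∧ ContinuousOn (expMoment (velocity T u) ξ) (Icc 1 b) ∧
    (∀ t ∈ Ioo 1 b, HasDerivAt (expMoment u ξ) (expMoment (velocity T u) ξ t) t) ∧
    ∀ t ∈ Ioo 1 b, HasDerivAt (expMoment (velocity T u) ξ) (expMomentAccel α μ p T u ξ t) t := by
  have hT := h.one_lt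
  have hu := h.contDiffOn_uncurry
  have hbT : ∀ t, t ≤ b → (t : EReal) < T := fun t ht => lt_of_le_of_lt (by exact_mod_cast ht) hb
  set K := Metric.closedBall (0 : EuclideanSpace ℝ (Fin n)) (lightRadius α b + R) with hK
  have hKc : IsCompact K := isCompact_closedBall _ _
  have hout : ∀ t ∈ Icc 1 b, ∀ x, x ∉ K → lightRadius α t + R < ‖x‖ := by
    intro t ht x hx
    have h1 : lightRadius α b + R < ‖x‖ := by simpa [hK] using hx
    have := lightRadius_mono hα₁ (zero_le_one.trans ht.1) ht.2
    linarith
  have hio : Ioo 1 b ⊆ Icc 1 b := Ioo_subset_Icc_self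
  have hsub : Icc 1 b ×ˢ univ ⊆ slab n T := fun z hz => ⟨hz.1.1, hbT _ hz.1.2⟩
  have hsubo : Ioo 1 b ×ˢ univ ⊆ openSlab n T := fun z hz => ⟨hz.1.1, hbT _ hz.1.2.le⟩
  have hoc : Ioo 1 b ×ˢ (univ : Set (EuclideanSpace ℝ (Fin n))) ⊆ Icc 1 b ×ˢ univ :=
    prod_mono hio le_rfl
  have cE : ∀ S : Set (ℝ × EuclideanSpace ℝ (Fin n)),
      ContinuousOn (fun z => Real.exp ⟪ξ, z.2⟫_ℝ) S := fun S =>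
    (((contDiff_exp_inner ξ (k := 0)).continuous).comp continuous_snd).continuousOn
  have cu : ContinuousOn (Function.uncurry fun t x => u t x * Real.exp ⟪ξ, x⟫_ℝ)
      (Icc 1 b ×ˢ univ) := (hu.continuousOn.mono hsub).mul (cE _)
  have cv : ContinuousOn (Function.uncurry fun t x => velocity T u t x * Real.exp ⟪ξ, x⟫_ℝ)
      (Icc 1 b ×ˢ univ) := ((continuousOn_velocity hT hu).mono hsub).mul (cE _)
  have cvt : ContinuousOn (Function.uncurry fun t x =>
      fderiv ℝ (Function.uncurry (velocity T u)) (t, x) (1, 0) * Real.exp ⟪ξ, x⟫_ℝ)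
      (Ioo 1 b ×ˢ univ) := ((continuousOn_deriv_velocity hu).mono hsubo).mul (cE _)
  have su : ∀ t ∈ Icc 1 b, ∀ x, x ∉ K → u t x * Real.exp ⟪ξ, x⟫_ℝ = 0 := fun t ht x hx => by
    rw [hs t ht.1 (hbT t ht.2) x (hout t ht x hx), zero_mul]
  have hV0 : ∀ t ∈ Icc 1 b, ∀ x, x ∉ K → velocity T u t x = 0 := fun t ht x hx =>
    hs.velocity_eq_zero hT hu ht.1 (hbT t ht.2) (hout t ht x hx)
  have sv : ∀ t ∈ Icc 1 b, ∀ x, x ∉ K → velocity T u t x * Real.exp ⟪ξ, x⟫_ℝ = 0 :=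
    fun t ht x hx => by rw [hV0 t ht x hx, zero_mul]
  have svt : ∀ t ∈ Ioo 1 b, ∀ x, x ∉ K →
      fderiv ℝ (Function.uncurry (velocity T u)) (t, x) (1, 0) * Real.exp ⟪ξ, x⟫_ℝ = 0 := by
    intro t ht x hx
    have e : (fun s => velocity T u s x) =ᶠ[𝓝 t] fun _ => 0 := by
      filter_upwards [Ioo_mem_nhds ht.1 ht.2] with s hs
      exact hV0 s (hio hs) x hx
    rw [(hasDerivAt_velocity hu ht.1 (hbT t ht.2.le) x).unique
      ((hasDerivAt_const t (0 : ℝ)).congr_of_eventuallyEq e), zero_mul]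
  refine ⟨continuousOn_integral_of_compact_support hKc cu fun t x ht hx => su t ht x hx,
    continuousOn_integral_of_compact_support hKc cv fun t x ht hx => sv t ht x hx,
    fun t ht => hasDerivAt_integral_of_isCompact hKc (cu.mono hoc) (cv.mono hoc)
      (fun t ht x => (hasDerivAt_time hu ht.1 (hbT t ht.2.le) x).mul_const _)
      (fun t ht => su t (hio ht)) (fun t ht => sv t (hio ht)) ht, fun t ht => ?_⟩
  have hd := hasDerivAt_integral_of_isCompact hKc (cv.mono hoc) cvt
      (fun t ht x => (hasDerivAt_velocity hu ht.1 (hbT t ht.2.le) x).mul_const _)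
      (fun t ht => sv t (hio ht)) svt ht
  have htT := hbT t ht.2.le
  have hu2 : ContDiff ℝ 2 (u t) := contDiff_slice hu ht.1.le htT
  have hus := hs.hasCompactSupport ht.1.le htT
  have hec : Continuous fun x : EuclideanSpace ℝ (Fin n) => Real.exp ⟪ξ, x⟫_ℝ :=
    (contDiff_exp_inner ξ (k := 0)).continuous
  have i2 : Integrable fun x => velocity T u t x * Real.exp ⟪ξ, x⟫_ℝ :=
    ((contDiff_velocity_slice hu ht.1 htT).continuous.mul hec).integrable_of_hasCompactSupport
      (HasCompactSupport.intro hKc (sv t (hio ht)))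
  have i3 : Integrable fun x => ‖∇ (u t) x‖ ^ p * Real.exp ⟪ξ, x⟫_ℝ := by
    refine Continuous.integrable_of_hasCompactSupport (Continuous.mul ?_ hec)
      (HasCompactSupport.mul_right ?_)
    · exact (continuous_gradient (hu2.of_le (by norm_num))).norm.rpow_const
        fun x => Or.inr (by linarith)
    · exact (hs.hasCompactSupport_gradient ht.1.le htT).comp_left (g := fun v => ‖v‖ ^ p)
        (by rw [norm_zero, Real.zero_rpow (by linarith)])
  have i1 : Integrable fun x => Laplacian.laplacian (u t) x * Real.exp ⟪ξ, x⟫_ℝ := by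
    refine Continuous.integrable_of_hasCompactSupport ((continuous_laplacian hu2).mul hec)
      (HasCompactSupport.mul_right (HasCompactSupport.intro hus fun x hx => ?_))
    have e : u t =ᶠ[𝓝 x] fun _ => 0 := notMem_tsupport_iff_eventuallyEq.1 hx
    have := (InnerProductSpace.laplacian_congr_nhds e).eq_of_nhds
    rw [this, InnerProductSpace.laplacian_const, Pi.zero_apply]
  have hint : ∫ x, fderiv ℝ (Function.uncurry (velocity T u)) (t, x) (1, 0) * Real.exp ⟪ξ, x⟫_ℝ
      = expMomentAccel α μ p T u ξ t := by
    unfold expMomentAccel expMoment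
    rw [← integral_laplacian_exp hu2 hus ξ, ← integral_const_mul, ← integral_const_mul,
      ← integral_sub (i1.const_mul _) (i2.const_mul _)]
    have i4 : Integrable fun x => 1 / t ^ (2 * α) * (Laplacian.laplacian (u t) x
        * Real.exp ⟪ξ, x⟫_ℝ) - μ / t * (velocity T u t x * Real.exp ⟪ξ, x⟫_ℝ) :=
      (i1.const_mul _).sub (i2.const_mul _)
    rw [← integral_add i4 i3]
    congr 1
    ext x
    rw [h.deriv_velocity ht.1 htT x]
    ring
  rw [hint] at hd
  exact hd

end Moments

end

/-! ### Growth of the exponential moments and of the L¹ norm of the gradient -/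

section

variable {n : ℕ}

theorem integral_pos_of_compactlySupported {g : EuclideanSpace ℝ (Fin n) → ℝ} (hg : Continuous g)
    (hs : HasCompactSupport g) (hg0 : ∀ x, 0 ≤ g x) (hne : g ≠ 0) : 0 < ∫ x, g x := by
  obtain ⟨x, hx⟩ := Function.ne_iff.1 hne
  exact hg.integral_pos_of_hasCompactSupport_nonneg_nonzero hs hg0 hx

theorem exp_moment_lower {R : ℝ} {g : EuclideanSpace ℝ (Fin n) → ℝ} (hg : Continuous g)
    (hs : tsupport g ⊆ Metric.closedBall 0 R) (hg0 : ∀ x, 0 ≤ g x) {κ : ℝ} (hκ : 0 ≤ κ)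
    {ξ : EuclideanSpace ℝ (Fin n)} (hξ : ‖ξ‖ ≤ κ) :
    Real.exp (-(κ * R)) * ∫ x, g x ≤ ∫ x, g x * Real.exp ⟪ξ, x⟫_ℝ := by
  have hcs : HasCompactSupport g := (isCompact_closedBall _ _).of_isClosed_subset
    (isClosed_tsupport g) hs
  rw [← integral_const_mul]
  refine integral_mono ((hg.integrable_of_hasCompactSupport hcs).const_mul _)
    ((hg.mul (contDiff_exp_inner ξ (k := 0)).continuous).integrable_of_hasCompactSupport
      hcs.mul_right) fun x => ?_
  simp only
  rw [mul_comm]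
  by_cases hx : x ∈ tsupport g
  · have h1 : ‖x‖ ≤ R := by simpa using hs hx
    have h2 : |⟪ξ, x⟫_ℝ| ≤ κ * R := (abs_real_inner_le_norm ξ x).trans (by gcongr)
    have := neg_le_of_abs_le h2
    have := hg0 x
    gcongr
  · rw [image_eq_zero_of_notMem_tsupport hx, zero_mul, zero_mul]

theorem hasDerivAt_rpow_mul_exp_lightRadius {α t : ℝ} (hα₁ : α < 1) (ht : 0 < t) (b κ : ℝ) :
    HasDerivAt (fun s => s ^ b * Real.exp (κ * lightRadius α s))
      ((b * t ^ (b - 1) + κ * t ^ (b - α)) * Real.exp (κ * lightRadius α t)) t := by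
  have h := (Real.hasDerivAt_rpow_const (p := b) (Or.inl ht.ne')).mul
    (((hasDerivAt_lightRadius hα₁ ht).const_mul κ).exp)
  convert! h using 1
  rw [Real.rpow_sub ht b α, Real.rpow_neg ht.le]
  ring

/-- `t ^ b * e ^ (κ A(t))` is a subsolution of the equation satisfied by the exponential moments. -/
theorem subsolution_inequality {α μ δ κ t b : ℝ} (hα₁ : α < 1)
    (hb : b = (α - μ) / 2 - δ) (hκ : |b * (b - 1 + μ)| ≤ 2 * δ * κ) (ht : 1 ≤ t) :
    (b * ((b - 1) * t ^ (b - 1 - 1) + κ * t ^ (b - 1 - α))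
        + κ * ((b - α) * t ^ (b - α - 1) + κ * t ^ (b - α - α)))
      + μ / t * (b * t ^ (b - 1) + κ * t ^ (b - α)) ≤ 1 / t ^ (2 * α) * (κ ^ 2 * t ^ b) := by
  have t0 : 0 < t := by linarith
  have hq : 0 < t ^ b := Real.rpow_pos_of_pos t0 _
  set q := t ^ b with hq'
  set τ := t ^ (-α) with hτ
  have hτ1 : 1 / t ≤ τ := by
    rw [one_div, ← Real.rpow_neg_one]
    exact Real.rpow_le_rpow_of_exponent_le ht (by linarith)
  have e1 : t ^ (b - 1) = q / t := by rw [Real.rpow_sub_one t0.ne']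
  have e2 : t ^ (b - 1 - 1) = q / t ^ 2 := by
    rw [Real.rpow_sub_one t0.ne', e1]; field_simp
  have e3 : ∀ c : ℝ, t ^ (c - α) = t ^ c * τ := fun c => by
    rw [Real.rpow_sub t0, hτ, Real.rpow_neg t0.le]; rfl
  have e4 : t ^ (b - α - 1) = q * τ / t := by rw [Real.rpow_sub_one t0.ne', e3]
  have e5 : 1 / t ^ (2 * α) = τ ^ 2 := by
    rw [one_div, ← Real.rpow_neg t0.le, hτ, ← Real.rpow_natCast, ← Real.rpow_mul t0.le]
    congr 1; push_cast; ring
  rw [e5, e3 (b - 1), e3 (b - α), e3 b, e4, e1, e2]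
  have h1 : b * (b - 1 + μ) * (1 / t) ≤ 2 * δ * κ * τ := by
    have : 0 ≤ 2 * δ * κ := (abs_nonneg _).trans hκ
    calc b * (b - 1 + μ) * (1 / t) ≤ 2 * δ * κ * (1 / t) :=
          mul_le_mul_of_nonneg_right ((le_abs_self _).trans hκ) (by positivity)
      _ ≤ _ := by gcongr
  have h2 : (b * ((b - 1) * (q / t ^ 2) + κ * (q / t * τ))
        + κ * ((b - α) * (q * τ / t) + κ * (q * τ * τ)))
      + μ / t * (b * (q / t) + κ * (q * τ))
      = q / t * (b * (b - 1 + μ) * (1 / t) + κ * (2 * b - α + μ) * τ) + τ ^ 2 * (κ ^ 2 * q) := by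
    field_simp
    ring
  rw [h2]
  -- By the choice of b, 2b - α + μ = -2δ. The resulting negative term of size t^(-α) dominates the
  -- 1/t remainder once κ is large, because 1/t ≤ t^(-α).
  have h3 : b * (b - 1 + μ) * (1 / t) + κ * (2 * b - α + μ) * τ ≤ 0 := by
    rw [hb] at h1 ⊢
    linarith
  have h4 : q / t * (b * (b - 1 + μ) * (1 / t) + κ * (2 * b - α + μ) * τ) ≤ 0 :=
    mul_nonpos_of_nonneg_of_nonpos (by positivity) h3
  linarith

variable {α μ p R : ℝ} {u₀ u₁ : EuclideanSpace ℝ (Fin n) → ℝ}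

theorem expMoment_one {ε : ℝ} {T : EReal} {u : ℝ → EuclideanSpace ℝ (Fin n) → ℝ}
    (h : IsClassicalSolution α μ p ε u₀ u₁ T u) (ξ : EuclideanSpace ℝ (Fin n)) :
    expMoment u ξ 1 = ε * ∫ x, u₀ x * Real.exp ⟪ξ, x⟫_ℝ := by
  rw [expMoment, ← integral_const_mul]
  simp_rw [h.initial, mul_assoc]

theorem expMoment_velocity_one {ε : ℝ} {T : EReal} {u : ℝ → EuclideanSpace ℝ (Fin n) → ℝ}
    (h : IsClassicalSolution α μ p ε u₀ u₁ T u) (ξ : EuclideanSpace ℝ (Fin n)) :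
    expMoment (velocity T u) ξ 1 = ε * ∫ x, u₁ x * Real.exp ⟪ξ, x⟫_ℝ := by
  rw [expMoment, ← integral_const_mul]
  simp_rw [velocity_one h.one_lt h.contDiffOn_uncurry, h.initial_deriv, mul_assoc]

/-- The nonnegative source is discarded and the moment is compared with a multiple of the
subsolution t^b e^(‖ξ‖A(t)). Confining ‖ξ‖ to [κ, κ₁] makes the constant uniform in ξ, as the later
average over ξ needs. -/
theorem exists_expMoment_lower (hα₁ : α < 1) (hp : 1 < p)
    (hu₀ : Continuous u₀) (hu₁ : Continuous u₁)
    (hu₀_nonneg : ∀ x, 0 ≤ u₀ x) (hu₁_nonneg : ∀ x, 0 ≤ u₁ x)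
    (hu₀_ne : u₀ ≠ 0) (hu₁_ne : u₁ ≠ 0)
    (hu₀_supp : tsupport u₀ ⊆ Metric.closedBall 0 R)
    (hu₁_supp : tsupport u₁ ⊆ Metric.closedBall 0 R) {b δ κ κ₁ : ℝ} (hδ : 0 < δ)
    (hb : b = (α - μ) / 2 - δ) (hκ0 : 0 < κ) (hκ : |b * (b - 1 + μ)| ≤ 2 * δ * κ) (hκ₁ : κ ≤ κ₁) :
    ∃ c : ℝ, 0 < c ∧ ∀ ε : ℝ, 0 < ε → ∀ (T : EReal) (u : ℝ → EuclideanSpace ℝ (Fin n) → ℝ),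
      IsClassicalSolution α μ p ε u₀ u₁ T u → SupportedInCone α R T u →
      ∀ t : ℝ, 1 ≤ t → (t : EReal) < T → ∀ ξ, κ ≤ ‖ξ‖ → ‖ξ‖ ≤ κ₁ →
        c * ε * (t ^ b * Real.exp (‖ξ‖ * lightRadius α t)) ≤ expMoment u ξ t := by
  have cs : ∀ {g : EuclideanSpace ℝ (Fin n) → ℝ}, tsupport g ⊆ Metric.closedBall 0 R →
      HasCompactSupport g := fun hg =>
    (isCompact_closedBall _ _).of_isClosed_subset (isClosed_tsupport _) hg
  have hκ₁0 : 0 ≤ κ₁ := hκ0.le.trans hκ₁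
  set c₀ := Real.exp (-(κ₁ * R)) * ∫ x, u₀ x with hc₀
  set c₁ := Real.exp (-(κ₁ * R)) * ∫ x, u₁ x with hc₁
  have hc₀p : 0 < c₀ := mul_pos (Real.exp_pos _)
    (integral_pos_of_compactlySupported hu₀ (cs hu₀_supp) hu₀_nonneg hu₀_ne)
  have hc₁p : 0 < c₁ := mul_pos (Real.exp_pos _)
    (integral_pos_of_compactlySupported hu₁ (cs hu₁_supp) hu₁_nonneg hu₁_ne)
  have hD : 0 < |b| + κ₁ + 1 := by positivity
  -- At time 1 the subsolution has value cε and slope cε(b + ‖ξ‖); both must lie below the initial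
  -- moments, whose uniform lower bounds are ε c₀ and ε c₁.
  obtain ⟨c, hc, hcm⟩ : ∃ c, 0 < c ∧ c < min c₀ (c₁ / (|b| + κ₁ + 1)) :=
    exists_between (lt_min hc₀p (by positivity))
  have hcc₀ : c < c₀ := hcm.trans_le (min_le_left _ _)
  have hcc₁ : c * (|b| + κ₁ + 1) < c₁ := (lt_div_iff₀ hD).1 (hcm.trans_le (min_le_right _ _))
  refine ⟨c, hc, fun ε hε T u h hs t h1 ht ξ hξ hξ₁ => ?_⟩
  obtain ⟨k1, k2, k3, k4⟩ := expMoment_calculus h hs hα₁ ξ hp ht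
  set ℓ := ‖ξ‖ with hℓ
  have hℓ0 : 0 < ℓ := hκ0.trans_le hξ
  have hκℓ : |b * (b - 1 + μ)| ≤ 2 * δ * ℓ := hκ.trans (by gcongr)
  let E : ℝ → ℝ := fun s => Real.exp (ℓ * lightRadius α s)
  let y : ℝ → ℝ := fun s => c * ε * (s ^ b * E s)
  let y₁ : ℝ → ℝ := fun s => c * ε * (b * (s ^ (b - 1) * E s) + ℓ * (s ^ (b - α) * E s))
  let y₂ : ℝ → ℝ := fun s => c * ε * (b * (((b - 1) * s ^ (b - 1 - 1) + ℓ * s ^ (b - 1 - α)) * E s)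
    + ℓ * (((b - α) * s ^ (b - α - 1) + ℓ * s ^ (b - α - α)) * E s))
  have hy : ∀ s, 0 < s → HasDerivAt y (y₁ s) s := by
    intro s hs0
    have := (hasDerivAt_rpow_mul_exp_lightRadius hα₁ hs0 b ℓ).const_mul (c * ε)
    convert! this using 1
    simp only [y₁, E]
    ring
  have hy₁ : ∀ s, 0 < s → HasDerivAt y₁ (y₂ s) s := fun s hs0 =>
    (((hasDerivAt_rpow_mul_exp_lightRadius hα₁ hs0 (b - 1) ℓ).const_mul b).add
      ((hasDerivAt_rpow_mul_exp_lightRadius hα₁ hs0 (b - α) ℓ).const_mul ℓ)).const_mul (c * ε)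
  have hpos : ∀ s ∈ Icc 1 t, (0 : ℝ) < s := fun s hs => zero_lt_one.trans_le hs.1
  have q0 := exp_moment_lower hu₀ hu₀_supp hu₀_nonneg hκ₁0 hξ₁
  have q1 := exp_moment_lower hu₁ hu₁_supp hu₁_nonneg hκ₁0 hξ₁
  have y0 : y 1 = c * ε := by simp [y, E, lightRadius_one]
  have y10 : y₁ 1 = c * ε * (b + ℓ) := by simp [y₁, E, lightRadius_one]
  have := (initial_le_of_damped_nonneg (μ := μ) zero_lt_one
    (w := fun s => expMoment u ξ s - y s)
    (w₁ := fun s => expMoment (velocity T u) ξ s - y₁ s)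
    (w₂ := fun s => expMomentAccel α μ p T u ξ s - y₂ s) (b := t)
    (k1.sub fun s hs => (hy s (hpos s hs)).continuousAt.continuousWithinAt)
    (k2.sub fun s hs => (hy₁ s (hpos s hs)).continuousAt.continuousWithinAt)
    (fun s hs => (k3 s hs).sub (hy s (hpos s (Ioo_subset_Icc_self hs))))
    (fun s hs => (k4 s hs).sub (hy₁ s (hpos s (Ioo_subset_Icc_self hs))))
    ?_ ?_ ?_ t ⟨h1, le_rfl⟩).1
  · have e : 0 < expMoment u ξ 1 - y 1 := by
      rw [expMoment_one h, y0]
      have : ε * c₀ ≤ ε * ∫ x, u₀ x * Real.exp ⟪ξ, x⟫_ℝ := by gcongr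
      nlinarith
    linarith
  · rw [expMoment_one h, y0]
    have : ε * c₀ ≤ ε * ∫ x, u₀ x * Real.exp ⟪ξ, x⟫_ℝ := by gcongr
    nlinarith
  · rw [expMoment_velocity_one h, y10]
    have h2 : ε * c₁ ≤ ε * ∫ x, u₁ x * Real.exp ⟪ξ, x⟫_ℝ := by gcongr
    have h3 : c * (b + ℓ) ≤ c * (|b| + κ₁ + 1) :=
      mul_le_mul_of_nonneg_left (by linarith [le_abs_self b]) hc.le
    have h4 : ε * (c * (b + ℓ)) ≤ ε * c₁ := by
      gcongr
      linarith
    linarith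
  · intro s hs hw
    have s0 : 0 < s := hpos s (Ioo_subset_Icc_self hs)
    have hsub := subsolution_inequality hα₁ hb hκℓ hs.1.le
    have hE : 0 < c * ε * E s := mul_pos (mul_pos hc hε) (Real.exp_pos _)
    have h2 := mul_le_mul_of_nonneg_left hsub hE.le
    have h3 : y₂ s + μ / s * y₁ s ≤ 1 / s ^ (2 * α) * (ℓ ^ 2 * y s) := by
      refine le_trans (le_of_eq ?_) (h2.trans (le_of_eq ?_))
      · simp only [y₂, y₁]; ring
      · simp only [y]; ring
    have h4 : 0 ≤ ∫ x, ‖∇ (u s) x‖ ^ p * Real.exp ⟪ξ, x⟫_ℝ :=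
      integral_nonneg fun x => by positivity
    have h5 : 1 / s ^ (2 * α) * (ℓ ^ 2 * y s) ≤ 1 / s ^ (2 * α) * (ℓ ^ 2 * expMoment u ξ s) := by
      have := Real.rpow_pos_of_pos s0 (2 * α)
      gcongr
      linarith
    simp only [expMomentAccel]
    linarith

/-- Complete the square: ⟨ξ, x⟩ - s‖ξ‖²/2 = ‖x‖²/(2s) - (s/2)‖ξ - x/s‖². The lower integral is used
because the formula serves inside Tonelli's theorem. -/
theorem lintegral_exp_inner_sub_sq {s : ℝ} (hs : 0 < s) (x : EuclideanSpace ℝ (Fin n)) :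
    ∫⁻ ξ : EuclideanSpace ℝ (Fin n), ENNReal.ofReal (Real.exp (⟪ξ, x⟫_ℝ - s * ‖ξ‖ ^ 2 / 2))
      = ENNReal.ofReal ((2 * Real.pi / s) ^ ((n : ℝ) / 2) * Real.exp (‖x‖ ^ 2 / (2 * s))) := by
  have hs2 : 0 < s / 2 := by positivity
  -- A nonintegrable function has Bochner integral 0, whereas the Gaussian formula gives a positive
  -- value.
  have hint : Integrable fun ξ : EuclideanSpace ℝ (Fin n) => Real.exp (-(s / 2) * ‖ξ‖ ^ 2) := by
    by_contra hni
    have h1 := GaussianFourier.integral_rexp_neg_mul_sq_norm (V := EuclideanSpace ℝ (Fin n)) hs2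
    rw [integral_undef hni] at h1
    have : 0 < (Real.pi / (s / 2)) ^ ((Module.finrank ℝ (EuclideanSpace ℝ (Fin n)) : ℝ) / 2) :=
      Real.rpow_pos_of_pos (by positivity) _
    linarith
  have e : ∀ ξ : EuclideanSpace ℝ (Fin n), Real.exp (⟪ξ, x⟫_ℝ - s * ‖ξ‖ ^ 2 / 2)
      = Real.exp (-(s / 2) * ‖ξ - (1 / s) • x‖ ^ 2) * Real.exp (‖x‖ ^ 2 / (2 * s)) := by
    intro ξ
    rw [← Real.exp_add]
    congr 1
    rw [norm_sub_sq_real, inner_smul_right, norm_smul, Real.norm_of_nonneg (by positivity)]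
    field_simp
    ring
  simp_rw [e]
  rw [← ofReal_integral_eq_lintegral_ofReal ((hint.comp_sub_right _).mul_const _)
    (Eventually.of_forall fun ξ => by positivity), integral_mul_const,
    integral_sub_right_eq_self (fun ξ : EuclideanSpace ℝ (Fin n) =>
      Real.exp (-(s / 2) * ‖ξ‖ ^ 2)),
    GaussianFourier.integral_rexp_neg_mul_sq_norm hs2]
  simp only [finrank_euclideanSpace_fin]
  rw [show Real.pi / (s / 2) = 2 * Real.pi / s by field_simp]

/-- In terms of radii this is (κ + d)^n - κ^n ≥ κ^(n-1) d. -/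
theorem volume_shell_ge (hn : 1 ≤ n) {κ d : ℝ} (hκ : 0 < κ) (hd : 0 < d) :
    ENNReal.ofReal (κ ^ (n - 1) * d) * volume (Metric.ball (0 : EuclideanSpace ℝ (Fin n)) 1)
      ≤ volume {ξ : EuclideanSpace ℝ (Fin n) | κ ≤ ‖ξ‖ ∧ ‖ξ‖ ≤ κ + d} := by
  have hset : {ξ : EuclideanSpace ℝ (Fin n) | κ ≤ ‖ξ‖ ∧ ‖ξ‖ ≤ κ + d}
      = Metric.closedBall 0 (κ + d) \ Metric.ball 0 κ := by
    ext ξ; simp [and_comm]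
  rw [hset]
  have : Nonempty (Fin n) := ⟨⟨0, hn⟩⟩
  refine le_trans ?_ le_measure_sdiff
  rw [Measure.addHaar_closedBall _ _ (by positivity), Measure.addHaar_ball _ _ hκ.le,
    finrank_euclideanSpace_fin]
  have hfin : volume (Metric.ball (0 : EuclideanSpace ℝ (Fin n)) 1) ≠ ⊤ := measure_ball_lt_top.ne
  rw [← ENNReal.sub_mul fun _ _ => hfin, ← ENNReal.ofReal_sub _ (by positivity)]
  gcongr
  obtain ⟨m, rfl⟩ : ∃ m, n = m + 1 := ⟨n - 1, by omega⟩
  simp only [Nat.add_sub_cancel]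
  have : κ ^ m ≤ (κ + d) ^ m := by gcongr; linarith
  rw [pow_succ, pow_succ]
  nlinarith

/-- A nonnegative function supported in a ball of radius `A + R` whose exponential moments are at
least `L e^{‖ξ‖A}` has integral at least of order `L A ^ ((n - 1) / 2)`. -/
theorem exists_integral_lower_of_expMoments (hn : 1 ≤ n) {κ A₀ : ℝ} (hκ : 0 < κ) (hA₀ : 0 < A₀)
    (hR : 0 < R) : ∃ c : ℝ, 0 < c ∧ ∀ (A L : ℝ) (g : EuclideanSpace ℝ (Fin n) → ℝ), A₀ ≤ A →
      Continuous g → (∀ x, 0 ≤ g x) → (∀ x, A + R < ‖x‖ → g x = 0) →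
      (∀ ξ : EuclideanSpace ℝ (Fin n), κ ≤ ‖ξ‖ → ‖ξ‖ ≤ κ + (A / κ) ^ (-(1 / 2 : ℝ)) →
        L * Real.exp (‖ξ‖ * A) ≤ ∫ x, g x * Real.exp ⟪ξ, x⟫_ℝ) → 0 ≤ L →
      c * (L * A ^ (((n : ℝ) - 1) / 2)) ≤ ∫ x, g x := by
  set ω := (volume (Metric.ball (0 : EuclideanSpace ℝ (Fin n)) 1)).toReal with hω
  have hω0 : 0 < ω := ENNReal.toReal_pos (Metric.measure_ball_pos _ _ zero_lt_one).ne'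
    measure_ball_lt_top.ne
  set M := Real.exp (1 / 2 + κ * R + R ^ 2 * κ / (2 * A₀)) with hM
  refine ⟨ω * κ ^ (n - 1) / M / (2 * Real.pi) ^ ((n : ℝ) / 2) / κ ^ (((n : ℝ) - 1) / 2),
    by positivity, fun A L g hA hg hg0 hgs hL hL0 => ?_⟩
  have hA0 : 0 < A := hA₀.trans_le hA
  have hcs : HasCompactSupport g := HasCompactSupport.intro (isCompact_closedBall 0 (A + R))
    fun x hx => hgs x (by simpa using hx)
  -- With this s the exponent rA - s r²/2 is maximal at r = κ, with value sκ²/2.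
  set s := A / κ with hs
  have hs0 : 0 < s := by positivity
  have hAs : A = s * κ := by rw [hs]; field_simp
  -- The width of the Gaussian: across the shell the exponent drops by at most 1/2.
  set d := s ^ (-(1 / 2 : ℝ)) with hd
  have hd0 : 0 < d := by positivity
  have hsd : s * d ^ 2 = 1 := by
    rw [hd, ← Real.rpow_natCast, ← Real.rpow_mul hs0.le]
    norm_num
    rw [Real.rpow_neg_one]
    field_simp
  set S : Set (EuclideanSpace ℝ (Fin n)) := {ξ | κ ≤ ‖ξ‖ ∧ ‖ξ‖ ≤ κ + d} with hS
  have hSm : MeasurableSet S :=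
    (measurableSet_le measurable_const measurable_norm).inter
      (measurableSet_le measurable_norm measurable_const)
  let k : EuclideanSpace ℝ (Fin n) → EuclideanSpace ℝ (Fin n) → ℝ :=
    fun ξ x => Real.exp (⟪ξ, x⟫_ℝ - s * ‖ξ‖ ^ 2 / 2)
  have hkc : Continuous (Function.uncurry k) := by
    simp only [k, Function.uncurry_def]; fun_prop
  have hlow : ∀ ξ ∈ S, ENNReal.ofReal (L * Real.exp (s * κ ^ 2 / 2 - 1 / 2))
      ≤ ∫⁻ x, ENNReal.ofReal (g x * k ξ x) := by
    intro ξ hξ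
    have c1 : Continuous fun x => g x * k ξ x :=
      hg.mul (hkc.comp (f := fun x => (ξ, x)) (by fun_prop))
    rw [← ofReal_integral_eq_lintegral_ofReal
      (c1.integrable_of_hasCompactSupport hcs.mul_right)
      (Eventually.of_forall fun x => mul_nonneg (hg0 x) (Real.exp_pos _).le)]
    refine ENNReal.ofReal_le_ofReal ?_
    have e1 : ∀ x, g x * k ξ x = (g x * Real.exp ⟪ξ, x⟫_ℝ) * Real.exp (-(s * ‖ξ‖ ^ 2 / 2)) := by
      intro x
      simp only [k]
      rw [sub_eq_add_neg, Real.exp_add, mul_assoc]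
    simp_rw [e1]
    rw [integral_mul_const]
    have h2 := mul_le_mul_of_nonneg_right (hL ξ hξ.1 hξ.2)
      (Real.exp_pos (-(s * ‖ξ‖ ^ 2 / 2))).le
    refine le_trans ?_ h2
    rw [mul_assoc, ← Real.exp_add]
    gcongr
    have h3 : (‖ξ‖ - κ) ^ 2 ≤ d ^ 2 := by
      have := hξ.1
      have := hξ.2
      gcongr
      linarith
    have h4 : s * (‖ξ‖ - κ) ^ 2 ≤ 1 := by rw [← hsd]; gcongr
    rw [hAs]
    nlinarith
  -- Integrate the moment bound over the shell, enlarge to all ξ, and swap the integrals. The shell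
  -- has volume of order s^(-1/2) and the full Gaussian integral carries s^(-n/2); their ratio is
  -- the gain s^((n-1)/2).
  have hchain : ENNReal.ofReal (L * Real.exp (s * κ ^ 2 / 2 - 1 / 2)) * volume S
      ≤ ENNReal.ofReal ((2 * Real.pi / s) ^ ((n : ℝ) / 2) * Real.exp ((A + R) ^ 2 / (2 * s)))
        * ENNReal.ofReal (∫ x, g x) := by
    calc ENNReal.ofReal (L * Real.exp (s * κ ^ 2 / 2 - 1 / 2)) * volume S
        = ∫⁻ _ in S, ENNReal.ofReal (L * Real.exp (s * κ ^ 2 / 2 - 1 / 2)) := by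
          rw [setLIntegral_const]
      _ ≤ ∫⁻ ξ in S, ∫⁻ x, ENNReal.ofReal (g x * k ξ x) := setLIntegral_mono' hSm hlow
      _ ≤ ∫⁻ ξ, ∫⁻ x, ENNReal.ofReal (g x * k ξ x) := setLIntegral_le_lintegral _ _
      _ = ∫⁻ x, ∫⁻ ξ, ENNReal.ofReal (g x * k ξ x) := by
          refine lintegral_lintegral_swap ?_
          have : Continuous (Function.uncurry fun ξ x => g x * k ξ x) :=
            (hg.comp continuous_snd).mul hkc
          exact this.measurable.ennreal_ofReal.aemeasurable
      _ ≤ ∫⁻ x, ENNReal.ofReal ((2 * Real.pi / s) ^ ((n : ℝ) / 2)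
            * Real.exp ((A + R) ^ 2 / (2 * s))) * ENNReal.ofReal (g x) := by
          refine lintegral_mono fun x => ?_
          simp_rw [ENNReal.ofReal_mul (hg0 x)]
          rw [lintegral_const_mul' _ _ ENNReal.ofReal_ne_top, lintegral_exp_inner_sub_sq hs0,
            mul_comm]
          rcases le_or_gt ‖x‖ (A + R) with hx | hx
          · gcongr
          · rw [hgs x hx]; simp
      _ = _ := by
          rw [lintegral_const_mul' _ _ ENNReal.ofReal_ne_top,
            ofReal_integral_eq_lintegral_ofReal (hg.integrable_of_hasCompactSupport hcs)
              (Eventually.of_forall hg0)]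
  have hG : 0 ≤ ∫ x, g x := integral_nonneg hg0
  have hreal : L * Real.exp (s * κ ^ 2 / 2 - 1 / 2) * (κ ^ (n - 1) * d * ω)
      ≤ (2 * Real.pi / s) ^ ((n : ℝ) / 2) * Real.exp ((A + R) ^ 2 / (2 * s)) * ∫ x, g x := by
    have h1 := (mul_le_mul_right (volume_shell_ge hn hκ hd0)
      (ENNReal.ofReal (L * Real.exp (s * κ ^ 2 / 2 - 1 / 2)))).trans hchain
    rw [← ENNReal.ofReal_toReal (measure_ball_lt_top (x := (0 : EuclideanSpace ℝ (Fin n)))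
      (r := 1) (μ := volume)).ne, ← ENNReal.ofReal_mul (by positivity),
      ← ENNReal.ofReal_mul (by positivity), ← ENNReal.ofReal_mul (by positivity)] at h1
    exact (ENNReal.ofReal_le_ofReal_iff (by positivity)).1 h1
  -- The exponents on the two sides differ by a bounded amount: (A + R)²/(2s) = sκ²/2 + κR +
  -- R²κ/(2A), and A ≥ A₀ bounds the last term.
  have hexp : Real.exp ((A + R) ^ 2 / (2 * s)) ≤ M * Real.exp (s * κ ^ 2 / 2 - 1 / 2) := by
    rw [hM, ← Real.exp_add]
    gcongr
    have e1 : (A + R) ^ 2 / (2 * s) = s * κ ^ 2 / 2 + κ * R + R ^ 2 * κ / (2 * A) := by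
      rw [hAs]; field_simp; ring
    have e2 : R ^ 2 * κ / (2 * A) ≤ R ^ 2 * κ / (2 * A₀) := by gcongr
    rw [e1]
    linarith
  have hE := Real.exp_pos (s * κ ^ 2 / 2 - 1 / 2)
  have h5 : L * (κ ^ (n - 1) * d * ω) ≤ (2 * Real.pi / s) ^ ((n : ℝ) / 2) * M * ∫ x, g x := by
    have h6 : (2 * Real.pi / s) ^ ((n : ℝ) / 2) * Real.exp ((A + R) ^ 2 / (2 * s)) * ∫ x, g x
        ≤ (2 * Real.pi / s) ^ ((n : ℝ) / 2) * (M * Real.exp (s * κ ^ 2 / 2 - 1 / 2)) *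
          ∫ x, g x := by gcongr
    refine le_of_mul_le_mul_right ?_ hE
    calc _ = L * Real.exp (s * κ ^ 2 / 2 - 1 / 2) * (κ ^ (n - 1) * d * ω) := by ring
      _ ≤ _ := hreal.trans h6
      _ = _ := by ring
  have e1 : A ^ (((n : ℝ) - 1) / 2) = s ^ ((n : ℝ) / 2) * d * κ ^ (((n : ℝ) - 1) / 2) := by
    rw [hd, ← Real.rpow_add hs0, hAs, Real.mul_rpow hs0.le hκ.le]
    congr 2
    ring
  rw [e1]
  have hP : 0 < (2 * Real.pi) ^ ((n : ℝ) / 2) := by positivity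
  have hK : 0 < κ ^ (((n : ℝ) - 1) / 2) := by positivity
  have hsn : 0 < s ^ ((n : ℝ) / 2) := by positivity
  have hM0 : 0 < M := Real.exp_pos _
  rw [Real.div_rpow (by positivity) hs0.le] at h5
  have e2 : ω * κ ^ (n - 1) / M / (2 * Real.pi) ^ ((n : ℝ) / 2) / κ ^ (((n : ℝ) - 1) / 2)
      * (L * (s ^ ((n : ℝ) / 2) * d * κ ^ (((n : ℝ) - 1) / 2)))
      = (L * (κ ^ (n - 1) * d * ω)) * (s ^ ((n : ℝ) / 2) / (M * (2 * Real.pi) ^ ((n : ℝ) / 2))) := by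
    field_simp
  rw [e2]
  calc _ ≤ ((2 * Real.pi) ^ ((n : ℝ) / 2) / s ^ ((n : ℝ) / 2) * M * ∫ x, g x)
        * (s ^ ((n : ℝ) / 2) / (M * (2 * Real.pi) ^ ((n : ℝ) / 2))) := by gcongr
    _ = ∫ x, g x := by field_simp

theorem exists_integral_norm_gradient_lower (hn : 1 ≤ n) (hα₁ : α < 1) (hp : 1 < p)
    (hR : 0 < R) (hu₀ : Continuous u₀) (hu₁ : Continuous u₁)
    (hu₀_nonneg : ∀ x, 0 ≤ u₀ x) (hu₁_nonneg : ∀ x, 0 ≤ u₁ x)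
    (hu₀_ne : u₀ ≠ 0) (hu₁_ne : u₁ ≠ 0)
    (hu₀_supp : tsupport u₀ ⊆ Metric.closedBall 0 R)
    (hu₁_supp : tsupport u₁ ⊆ Metric.closedBall 0 R) {b δ : ℝ} (hδ : 0 < δ)
    (hb : b = (α - μ) / 2 - δ) :
    ∃ c : ℝ, 0 < c ∧ ∀ ε : ℝ, 0 < ε → ∀ (T : EReal) (u : ℝ → EuclideanSpace ℝ (Fin n) → ℝ),
      IsClassicalSolution α μ p ε u₀ u₁ T u → SupportedInCone α R T u →
      ∀ t : ℝ, 2 ≤ t → (t : EReal) < T →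
        c * ε * t ^ (b + (1 - α) * (((n : ℝ) - 1) / 2)) ≤ ∫ x, ‖∇ (u t) x‖ := by
  have hβ : 0 < 1 - α := by linarith
  set A₀ := lightRadius α 2 with hA₀
  have h21 : (1 : ℝ) < 2 ^ (1 - α) := Real.one_lt_rpow one_lt_two hβ
  have hA₀0 : 0 < A₀ := div_pos (by linarith) hβ
  -- Large enough for `subsolution_inequality`; the 1 keeps it positive.
  set κ := |b * (b - 1 + μ)| / (2 * δ) + 1 with hκ
  have hκ0 : 0 < κ := by positivity
  have hκb : |b * (b - 1 + μ)| ≤ 2 * δ * κ := by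
    rw [hκ, mul_add (2 * δ), mul_div_cancel₀ _ (by positivity : 2 * δ ≠ 0)]
    linarith
  -- The shell gets thinner as A(t) grows, so its width at A₀ = A(2) serves for all t ≥ 2.
  obtain ⟨c₁, hc₁, H1⟩ := exists_expMoment_lower (κ₁ := κ + (A₀ / κ) ^ (-(1 / 2 : ℝ))) hα₁ hp hu₀
    hu₁ hu₀_nonneg hu₁_nonneg hu₀_ne hu₁_ne hu₀_supp hu₁_supp hδ hb hκ0 hκb
    (by have : 0 < (A₀ / κ) ^ (-(1 / 2 : ℝ)) := by positivity
        linarith)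
  obtain ⟨c₂, hc₂, H2⟩ := exists_integral_lower_of_expMoments hn hκ0 hA₀0 hR
  -- For t ≥ 2 one has t^(1-α) - 1 ≥ (1 - 2^(-(1-α))) t^(1-α), whence A(t) ≥ m t^(1-α).
  set m := (1 - (2 ^ (1 - α))⁻¹) / (1 - α) with hm
  have hm0 : 0 < m := div_pos (by have := inv_lt_one_of_one_lt₀ h21; linarith) hβ
  refine ⟨c₂ * (κ * c₁) * m ^ (((n : ℝ) - 1) / 2), by positivity,
    fun ε hε T u h hs t ht htT => ?_⟩
  have t0 : 0 < t := by linarith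
  have h1t : 1 ≤ t := by linarith
  have hu1 : ContDiff ℝ 1 (u t) :=
    (contDiff_slice h.contDiffOn_uncurry h1t htT).of_le (by norm_num)
  have hA : A₀ ≤ lightRadius α t := lightRadius_mono hα₁ (by norm_num) ht
  have hAt : m * t ^ (1 - α) ≤ lightRadius α t := by
    rw [hm, lightRadius, div_mul_eq_mul_div]
    gcongr
    have h3 : 2 ^ (1 - α) ≤ t ^ (1 - α) := Real.rpow_le_rpow (by norm_num) ht hβ.le
    have h4 : 1 ≤ (2 ^ (1 - α))⁻¹ * t ^ (1 - α) := by
      rw [← div_eq_inv_mul]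
      exact (one_le_div (by positivity)).2 h3
    linarith
  have key := H2 (lightRadius α t) (κ * (c₁ * ε * t ^ b)) (fun x => ‖∇ (u t) x‖) hA
    (continuous_gradient hu1).norm (fun x => norm_nonneg _)
    (fun x hx => by rw [hs.gradient_eq_zero h1t htT hx, norm_zero]) (fun ξ hξ hξ₁ => ?_)
    (by positivity)
  · refine le_trans ?_ key
    have hn1 : 0 ≤ ((n : ℝ) - 1) / 2 := by
      have : (1 : ℝ) ≤ n := by exact_mod_cast hn
      linarith
    have h3 := Real.rpow_le_rpow (by positivity) hAt hn1
    rw [Real.mul_rpow hm0.le (by positivity), ← Real.rpow_mul t0.le] at h3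
    rw [Real.rpow_add t0]
    calc _ = c₂ * (κ * (c₁ * ε * t ^ b) *
          (m ^ (((n : ℝ) - 1) / 2) * t ^ ((1 - α) * (((n : ℝ) - 1) / 2)))) := by ring
      _ ≤ _ := by gcongr
  · have hd : (lightRadius α t / κ) ^ (-(1 / 2 : ℝ)) ≤ (A₀ / κ) ^ (-(1 / 2 : ℝ)) :=
      Real.rpow_le_rpow_of_nonpos (by positivity) (by gcongr) (by norm_num)
    have h3 := H1 ε hε T u h hs t h1t htT ξ hξ (hξ₁.trans (by gcongr))
    have h4 := le_integral_norm_gradient_exp hu1 (hs.hasCompactSupport h1t htT)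
      (ξ := ξ) (hκ0.trans_le hξ)
    refine le_trans ?_ h4
    calc κ * (c₁ * ε * t ^ b) * Real.exp (‖ξ‖ * lightRadius α t)
        = κ * (c₁ * ε * (t ^ b * Real.exp (‖ξ‖ * lightRadius α t))) := by ring
      _ ≤ ‖ξ‖ * expMoment u ξ t := by gcongr

end

/-! ### Lower bounds for the mean, and the lifespan -/

section

variable {n : ℕ} {α μ p R : ℝ} {u₀ u₁ : EuclideanSpace ℝ (Fin n) → ℝ}

/-- Standing assumptions on the parameters and the initial data. -/
structure Admissible (α μ p R : ℝ) (u₀ u₁ : EuclideanSpace ℝ (Fin n) → ℝ) : Prop where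
  one_le_dim : 1 ≤ n
  α_nonneg : 0 ≤ α
  α_lt_one : α < 1
  μ_nonneg : 0 ≤ μ
  one_lt_p : 1 < p
  R_pos : 0 < R
  continuous₀ : Continuous u₀
  continuous₁ : Continuous u₁
  nonneg₀ : ∀ x, 0 ≤ u₀ x
  nonneg₁ : ∀ x, 0 ≤ u₁ x
  ne_zero₀ : u₀ ≠ 0
  ne_zero₁ : u₁ ≠ 0
  support₀ : tsupport u₀ ⊆ Metric.closedBall 0 R
  support₁ : tsupport u₁ ⊆ Metric.closedBall 0 R

theorem Admissible.supportedInCone (d : Admissible α μ p R u₀ u₁) {ε : ℝ} {T : EReal}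
    {u : ℝ → EuclideanSpace ℝ (Fin n) → ℝ} (h : IsClassicalSolution α μ p ε u₀ u₁ T u) :
    SupportedInCone α R T u := fun _ h1 ht _ hx =>
  h.eq_zero_of_lt_norm d.α_nonneg d.α_lt_one d.μ_nonneg d.one_lt_p d.support₀ d.support₁ h1 ht hx

theorem expMoment_zero (u : ℝ → EuclideanSpace ℝ (Fin n) → ℝ) (t : ℝ) :
    expMoment u 0 t = ∫ x, u t x := by
  simp [expMoment]

theorem expMomentAccel_zero (T : EReal) (u : ℝ → EuclideanSpace ℝ (Fin n) → ℝ) (t : ℝ) :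
    expMomentAccel α μ p T u 0 t + μ / t * expMoment (velocity T u) 0 t
      = ∫ x, ‖∇ (u t) x‖ ^ p := by
  simp [expMomentAccel]

theorem Admissible.integral_pos₀ (d : Admissible α μ p R u₀ u₁) : 0 < ∫ x, u₀ x :=
  integral_pos_of_compactlySupported d.continuous₀ ((isCompact_closedBall _ _).of_isClosed_subset
    (isClosed_tsupport _) d.support₀) d.nonneg₀ d.ne_zero₀

theorem Admissible.integral_pos₁ (d : Admissible α μ p R u₀ u₁) : 0 < ∫ x, u₁ x :=
  integral_pos_of_compactlySupported d.continuous₁ ((isCompact_closedBall _ _).of_isClosed_subset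
    (isClosed_tsupport _) d.support₁) d.nonneg₁ d.ne_zero₁

theorem lightRadius_add_le (hα₁ : α < 1) (hR : 0 < R) {t : ℝ} (ht : 1 ≤ t) :
    lightRadius α t + R ≤ (1 / (1 - α) + R) * t ^ (1 - α) := by
  have hβ : 0 < 1 - α := by linarith
  have h1 : 1 ≤ t ^ (1 - α) := Real.one_le_rpow ht hβ.le
  have h2 : lightRadius α t ≤ 1 / (1 - α) * t ^ (1 - α) := by
    rw [lightRadius, div_mul_eq_mul_div, one_mul]
    gcongr
    linarith
  nlinarith

theorem Admissible.exists_integral_rpow_lower (d : Admissible α μ p R u₀ u₁) :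
    ∃ c : ℝ, 0 < c ∧ ∀ (ε : ℝ) (T : EReal) (u : ℝ → EuclideanSpace ℝ (Fin n) → ℝ),
      IsClassicalSolution α μ p ε u₀ u₁ T u → ∀ t : ℝ, 1 ≤ t → (t : EReal) < T →
        c * t ^ (-((1 - α) * n * (p - 1))) * (∫ x, ‖∇ (u t) x‖) ^ p ≤ ∫ x, ‖∇ (u t) x‖ ^ p := by
  set ω := (volume (Metric.ball (0 : EuclideanSpace ℝ (Fin n)) 1)).toReal with hω
  have hω0 : 0 < ω := ENNReal.toReal_pos (Metric.measure_ball_pos _ _ zero_lt_one).ne'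
    measure_ball_lt_top.ne
  have hβ : 0 < 1 - α := by linarith [d.α_lt_one]
  have hR := d.R_pos
  set ρ := 1 / (1 - α) + R with hρ
  have hρ0 : 0 < ρ := by positivity
  refine ⟨((ρ ^ n * ω) ^ (p - 1))⁻¹, by positivity, fun ε T u h t h1 ht => ?_⟩
  have t0 : 0 < t := by linarith
  have hs := d.supportedInCone h
  have hu1 : ContDiff ℝ 1 (u t) :=
    (contDiff_slice h.contDiffOn_uncurry h1 ht).of_le (by norm_num)
  have hr := lightRadius_add_le d.α_lt_one hR h1
  have key := rpow_integral_le (n := n) (r := ρ * t ^ (1 - α)) (by positivity) d.one_lt_p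
    (continuous_gradient hu1).norm (fun x => norm_nonneg _)
    (fun x hx => by rw [hs.gradient_eq_zero h1 ht (hr.trans_lt hx), norm_zero])
  have e : ((ρ * t ^ (1 - α)) ^ n * ω) ^ (p - 1)
      = (ρ ^ n * ω) ^ (p - 1) * t ^ ((1 - α) * n * (p - 1)) := by
    rw [mul_pow, mul_right_comm, Real.mul_rpow (by positivity) (by positivity),
      ← Real.rpow_natCast (t ^ (1 - α)), ← Real.rpow_mul t0.le, ← Real.rpow_mul t0.le]
  rw [← hω, e] at key
  rw [Real.rpow_neg t0.le]
  have h2 : 0 < (ρ ^ n * ω) ^ (p - 1) := by positivity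
  have h3 : 0 < t ^ ((1 - α) * n * (p - 1)) := by positivity
  rw [← mul_inv, inv_mul_le_iff₀ (by positivity)]
  exact key

theorem Admissible.mean_monotone (d : Admissible α μ p R u₀ u₁) {ε : ℝ} (hε : 0 < ε) {T : EReal}
    {u : ℝ → EuclideanSpace ℝ (Fin n) → ℝ} (h : IsClassicalSolution α μ p ε u₀ u₁ T u) {t : ℝ}
    (h1 : 1 ≤ t) (ht : (t : EReal) < T) :
    0 < expMoment u 0 t ∧ 0 ≤ expMoment (velocity T u) 0 t := by
  obtain ⟨k1, k2, k3, k4⟩ := expMoment_calculus h (d.supportedInCone h) d.α_lt_one 0 d.one_lt_p ht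
  have i0 : 0 < expMoment u 0 1 := by
    rw [expMoment_one h]
    simpa using mul_pos hε d.integral_pos₀
  have i1 : 0 < expMoment (velocity T u) 0 1 := by
    rw [expMoment_velocity_one h]
    simpa using mul_pos hε d.integral_pos₁
  have := mono_of_damped_nonneg (μ := μ) zero_lt_one k1 k2 k3 k4 i1.le (fun s _ => by
    rw [expMomentAccel_zero]
    exact integral_nonneg fun x => by positivity) t ⟨h1, le_rfl⟩
  exact ⟨i0.trans_le this.1, this.2⟩

/-- The two bounds F ≤ ρ t^(1-α) ∫ |∇u| and ∫ |∇u|^p ≥ c t^(-(1-α)n(p-1)) (∫ |∇u|)^p combine into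
F'' + (μ/t) F' ≥ M F^p on [a, 2a] with M of order a^(-q). `not_damped_superlinear` then rules out
large a² M k^(p-1). -/
theorem Admissible.exists_blowup_criterion (d : Admissible α μ p R u₀ u₁) :
    ∃ D : ℝ, 0 < D ∧ ∀ ε : ℝ, 0 < ε → ∀ (T : EReal) (u : ℝ → EuclideanSpace ℝ (Fin n) → ℝ),
      IsClassicalSolution α μ p ε u₀ u₁ T u → ∀ a k : ℝ, 1 ≤ a → 0 < k → ((2 * a : ℝ) : EReal) < T →
        k < expMoment u 0 a → a ^ (2 - (1 - α) * (n * (p - 1) + p)) * k ^ (p - 1) < D := by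
  obtain ⟨c, hc, H⟩ := d.exists_integral_rpow_lower
  have hβ : 0 < 1 - α := by linarith [d.α_lt_one]
  have hR := d.R_pos
  have hμ := d.μ_nonneg
  have hp := d.one_lt_p
  have hp1 : 0 < p - 1 := by linarith
  set ρ := 1 / (1 - α) + R with hρ
  have hρ0 : 0 < ρ := by positivity
  set q := (1 - α) * (n * (p - 1) + p) with hq
  have hq0 : 0 ≤ q := by positivity
  -- The factor 2^(-q) comes from t^(-q) ≥ (2a)^(-q) on the interval.
  set c' := c / ρ ^ p * 2 ^ (-q) with hc'
  have hc'0 : 0 < c' := by positivity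
  refine ⟨4 * (2 / (p - 1)) * (2 / (p - 1) + 2 + μ) / c', by positivity,
    fun ε hε T u h a k ha hk hT hka => ?_⟩
  by_contra hcon
  rw [not_lt, div_le_iff₀ hc'0] at hcon
  have a0 : 0 < a := by linarith
  have hs := d.supportedInCone h
  obtain ⟨k1, k2, k3, k4⟩ := expMoment_calculus h hs d.α_lt_one 0 d.one_lt_p hT
  have s1 : Icc a (2 * a) ⊆ Icc 1 (2 * a) := Icc_subset_Icc_left ha
  have s2 : Ioo a (2 * a) ⊆ Ioo 1 (2 * a) := Ioo_subset_Ioo_left ha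
  have haT : (a : EReal) < T := lt_trans (by exact_mod_cast (by linarith : a < 2 * a)) hT
  refine not_damped_superlinear (μ := μ) (p := p) (M := c / ρ ^ p * (2 * a) ^ (-q)) ha hμ hp hk ?_
    (k1.mono s1) (k2.mono s1) (fun t ht => k3 t (s2 ht)) (fun t ht => k4 t (s2 ht)) hka
    (d.mean_monotone hε h ha haT).2 fun t ht hpos => ?_
  · refine hcon.trans (le_of_eq ?_)
    rw [hc', Real.mul_rpow (by norm_num) a0.le, sub_eq_add_neg, Real.rpow_add a0]
    norm_cast
    ring
  · have h1t : 1 ≤ t := ha.trans ht.1.le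
    have t0 : 0 < t := by linarith
    have htT : (t : EReal) < T := lt_trans (by exact_mod_cast ht.2) hT
    have hu1 : ContDiff ℝ 1 (u t) :=
      (contDiff_slice h.contDiffOn_uncurry h1t htT).of_le (by norm_num)
    have hr := lightRadius_add_le d.α_lt_one hR h1t
    have hF := integral_le_radius_mul_integral_norm_gradient (r := ρ * t ^ (1 - α)) d.one_le_dim
      hu1 (fun x hx => hs t h1t htT x (hr.trans_lt hx))
      (fun x hx => hs.gradient_eq_zero h1t htT (hr.trans_lt hx))
    rw [← expMoment_zero] at hF
    have hFp := Real.rpow_le_rpow hpos.le hF (by linarith : 0 ≤ p)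
    have hG : 0 ≤ ∫ x, ‖∇ (u t) x‖ := integral_nonneg fun x => norm_nonneg _
    rw [Real.mul_rpow (by positivity) hG, Real.mul_rpow hρ0.le (by positivity),
      ← Real.rpow_mul t0.le] at hFp
    rw [expMomentAccel_zero]
    refine le_trans ?_ (H ε T u h t h1t htT)
    have e1 : (2 * a) ^ (-q) ≤ t ^ (-q) :=
      Real.rpow_le_rpow_of_nonpos t0 ht.2.le (by linarith)
    have e2 : t ^ (-((1 - α) * n * (p - 1))) = t ^ (-q) * t ^ ((1 - α) * p) := by
      rw [← Real.rpow_add t0]; congr 1; rw [hq]; ring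
    rw [e2]
    calc c / ρ ^ p * (2 * a) ^ (-q) * expMoment u 0 t ^ p
        ≤ c / ρ ^ p * t ^ (-q) * (ρ ^ p * t ^ ((1 - α) * p) * (∫ x, ‖∇ (u t) x‖) ^ p) := by gcongr
      _ = _ := by
        have : 0 < ρ ^ p := by positivity
        field_simp

/-- The function t^(1-μ) solves the homogeneous equation w'' + (μ/t) w' = 0, and the source is
nonnegative. The smaller of the two data integrals makes both value and slope comparable at time 1.
-/
theorem Admissible.exists_mean_lower_linear (d : Admissible α μ p R u₀ u₁) :
    ∃ c : ℝ, 0 < c ∧ ∀ ε : ℝ, 0 < ε → ∀ (T : EReal) (u : ℝ → EuclideanSpace ℝ (Fin n) → ℝ),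
      IsClassicalSolution α μ p ε u₀ u₁ T u → ∀ a : ℝ, 1 ≤ a → (a : EReal) < T →
        c * ε * a ^ (1 - μ) ≤ expMoment u 0 a := by
  have i0 := d.integral_pos₀
  have i1 := d.integral_pos₁
  set c := min (∫ x, u₀ x) (∫ x, u₁ x) with hc
  have hc0 : 0 < c := lt_min i0 i1
  refine ⟨c, hc0, fun ε hε T u h a ha haT => ?_⟩
  obtain ⟨k1, k2, k3, k4⟩ := expMoment_calculus h (d.supportedInCone h) d.α_lt_one 0 d.one_lt_p haT
  have hy : ∀ (e t : ℝ), 0 < t → HasDerivAt (fun s => s ^ e) (e * t ^ (e - 1)) t :=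
    fun e t ht => Real.hasDerivAt_rpow_const (Or.inl ht.ne')
  have hpos : ∀ t ∈ Icc 1 a, (0 : ℝ) < t := fun t ht => zero_lt_one.trans_le ht.1
  have hy1 : ∀ t, 0 < t → HasDerivAt (fun s => c * ε * s ^ (1 - μ))
      (c * ε * (1 - μ) * t ^ (-μ)) t := fun t ht => by
    convert! (hy (1 - μ) t ht).const_mul (c * ε) using 1
    rw [show 1 - μ - 1 = -μ by ring]; ring
  have hy2 : ∀ t, 0 < t → HasDerivAt (fun s => c * ε * (1 - μ) * s ^ (-μ))
      (c * ε * (1 - μ) * (-μ * t ^ (-μ - 1))) t := fun t ht =>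
    (hy (-μ) t ht).const_mul (c * ε * (1 - μ))
  have := (mono_of_damped_nonneg (μ := μ) zero_lt_one
    (w := fun t => expMoment u 0 t - c * ε * t ^ (1 - μ))
    (w₁ := fun t => expMoment (velocity T u) 0 t - c * ε * (1 - μ) * t ^ (-μ))
    (w₂ := fun t => expMomentAccel α μ p T u 0 t - c * ε * (1 - μ) * (-μ * t ^ (-μ - 1)))
    (k1.sub fun t ht => (hy1 t (hpos t ht)).continuousAt.continuousWithinAt)
    (k2.sub fun t ht => (hy2 t (hpos t ht)).continuousAt.continuousWithinAt)
    (fun t ht => (k3 t ht).sub (hy1 t (hpos t (Ioo_subset_Icc_self ht))))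
    (fun t ht => (k4 t ht).sub (hy2 t (hpos t (Ioo_subset_Icc_self ht)))) ?_ ?_ a ⟨ha, le_rfl⟩).1
  · rw [expMoment_one h] at this
    simp only [inner_zero_left, Real.exp_zero, mul_one, Real.one_rpow] at this
    have h2 : ε * c ≤ ε * ∫ x, u₀ x := by gcongr; exact min_le_left _ _
    linarith
  · rw [expMoment_velocity_one h]
    simp only [inner_zero_left, Real.exp_zero, mul_one, Real.one_rpow]
    have h2 : ε * c ≤ ε * ∫ x, u₁ x := by gcongr; exact min_le_right _ _
    have h3 : 0 ≤ c * ε * μ := mul_nonneg (by positivity) d.μ_nonneg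
    linarith
  · intro t ht
    have t0 := hpos t (Ioo_subset_Icc_self ht)
    have h2 : 0 ≤ ∫ x, ‖∇ (u t) x‖ ^ p := integral_nonneg fun x => by positivity
    rw [← expMomentAccel_zero (α := α) (μ := μ) T u t] at h2
    rw [Real.rpow_sub_one t0.ne']
    refine h2.trans (le_of_eq ?_)
    field_simp
    ring

theorem rpow_ge_of_mem_half_interval {a t e : ℝ} (ha : 0 < a) (h1 : a / 2 ≤ t) (h2 : t ≤ a) :
    2 ^ (-|e|) * a ^ e ≤ t ^ e := by
  have t0 : 0 < t := by linarith
  rcases le_total 0 e with he | he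
  · rw [abs_of_nonneg he, Real.rpow_neg (by norm_num), inv_mul_eq_div,
      ← Real.div_rpow ha.le (by norm_num)]
    exact Real.rpow_le_rpow (by positivity) h1 he
  · rw [abs_of_nonpos he, neg_neg]
    have h3 : (2 : ℝ) ^ e ≤ 1 := Real.rpow_le_one_of_one_le_of_nonpos one_le_two he
    have h4 : a ^ e ≤ t ^ e := Real.rpow_le_rpow_of_nonpos t0 h2 he
    have h5 : 0 < a ^ e := Real.rpow_pos_of_pos ha _
    nlinarith

/-- On [a/2, a] the source is at least some K of order ε^p a^e, so F grows at least like a parabola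
started at a/2, which gains a². Taking a ≥ 4 keeps a/2 ≥ 2, where the gradient bound holds. -/
theorem Admissible.exists_mean_lower_superlinear (d : Admissible α μ p R u₀ u₁) {e : ℝ}
    (he : e = p * ((α - μ) / 2 - (1 - α) / p + (1 - α) * (((n : ℝ) - 1) / 2))
      - (1 - α) * n * (p - 1)) :
    ∃ c : ℝ, 0 < c ∧ ∀ ε : ℝ, 0 < ε → ∀ (T : EReal) (u : ℝ → EuclideanSpace ℝ (Fin n) → ℝ),
      IsClassicalSolution α μ p ε u₀ u₁ T u → ∀ a : ℝ, 4 ≤ a → (a : EReal) < T →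
        c * ε ^ p * a ^ (2 + e) ≤ expMoment u 0 a := by
  obtain ⟨c, hc, H⟩ := d.exists_integral_rpow_lower
  have hp := d.one_lt_p
  have hp0 : 0 < p := by linarith
  have hμ := d.μ_nonneg
  -- This loss costs t^(-(1-α)) after the p-th power, which is what turns the final exponent into
  -- (1-α)γ'/2.
  have hδ : 0 < (1 - α) / p := div_pos (by linarith [d.α_lt_one]) hp0
  obtain ⟨c₁, hc₁, H₁⟩ := exists_integral_norm_gradient_lower d.one_le_dim d.α_lt_one hp d.R_pos
    d.continuous₀ d.continuous₁ d.nonneg₀ d.nonneg₁ d.ne_zero₀ d.ne_zero₁ d.support₀ d.support₁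
    (μ := μ) hδ rfl
  refine ⟨c * c₁ ^ p * 2 ^ (-|e|) / (8 * (1 + μ)), by positivity, fun ε hε T u h a ha haT => ?_⟩
  have a0 : 0 < a := by linarith
  obtain ⟨k1, k2, k3, k4⟩ := expMoment_calculus h (d.supportedInCone h) d.α_lt_one 0 hp haT
  have s1 : Icc (a / 2) a ⊆ Icc 1 a := Icc_subset_Icc_left (by linarith)
  have s2 : Ioo (a / 2) a ⊆ Ioo 1 a := Ioo_subset_Ioo_left (by linarith)
  set K := c * c₁ ^ p * ε ^ p * (2 ^ (-|e|) * a ^ e) with hK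
  have hK0 : 0 < K := by positivity
  have hlow : ∀ t ∈ Ioo (a / 2) a, K ≤ ∫ x, ‖∇ (u t) x‖ ^ p := by
    intro t ht
    have t2 : 2 ≤ t := by linarith [ht.1]
    have t0 : 0 < t := by linarith
    have htT : (t : EReal) < T := lt_trans (by exact_mod_cast ht.2) haT
    refine le_trans ?_ (H ε T u h t (by linarith) htT)
    have h2 := H₁ ε hε T u h (d.supportedInCone h) t t2 htT
    have h3 := Real.rpow_le_rpow (by positivity) h2 hp0.le
    rw [Real.mul_rpow (by positivity) (by positivity), Real.mul_rpow hc₁.le hε.le,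
      ← Real.rpow_mul t0.le] at h3
    have h4 := rpow_ge_of_mem_half_interval (e := e) a0 ht.1.le ht.2.le
    calc K ≤ c * c₁ ^ p * ε ^ p * t ^ e := by rw [hK]; gcongr
      _ = c * t ^ (-((1 - α) * n * (p - 1))) * (c₁ ^ p * ε ^ p *
          t ^ (((α - μ) / 2 - (1 - α) / p + (1 - α) * (((n : ℝ) - 1) / 2)) * p)) := by
        rw [he, sub_eq_add_neg, Real.rpow_add t0, mul_comm p]
        ring
      _ ≤ _ := by gcongr
  -- Dividing by 1 + μ pays for the damping: (μ/t)(t - a/2) ≤ μ, so second derivative plus damping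
  -- term of the parabola is at most K.
  have hy : ∀ t, HasDerivAt (fun s => K / (2 * (1 + μ)) * (s - a / 2) ^ 2)
      (K / (1 + μ) * (t - a / 2)) t := fun t => by
    convert! (((hasDerivAt_id t).sub_const (a / 2)).pow 2).const_mul (K / (2 * (1 + μ))) using 1
    simp only [id]
    field_simp
    norm_num
    ring
  have hy1 : ∀ t, HasDerivAt (fun s => K / (1 + μ) * (s - a / 2)) (K / (1 + μ)) t := fun t => by
    simpa using ((hasDerivAt_id t).sub_const (a / 2)).const_mul (K / (1 + μ))
  have hhalf := d.mean_monotone hε h (t := a / 2) (by linarith)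
    (lt_trans (by exact_mod_cast (by linarith : a / 2 < a)) haT)
  have := (mono_of_damped_nonneg (μ := μ) (a := a / 2) (c := a) (by linarith)
    (w := fun t => expMoment u 0 t - K / (2 * (1 + μ)) * (t - a / 2) ^ 2)
    (w₁ := fun t => expMoment (velocity T u) 0 t - K / (1 + μ) * (t - a / 2))
    (w₂ := fun t => expMomentAccel α μ p T u 0 t - K / (1 + μ))
    ((k1.mono s1).sub fun t _ => (hy t).continuousAt.continuousWithinAt)
    ((k2.mono s1).sub fun t _ => (hy1 t).continuousAt.continuousWithinAt)
    (fun t ht => (k3 t (s2 ht)).sub (hy t)) (fun t ht => (k4 t (s2 ht)).sub (hy1 t))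
    (by simpa using hhalf.2) ?_ a ⟨by linarith, le_rfl⟩).1
  · simp only [sub_self, ne_eq, OfNat.ofNat_ne_zero, not_false_eq_true, zero_pow, mul_zero,
      sub_zero] at this
    have e1 : K / (2 * (1 + μ)) * (a - a / 2) ^ 2
        = c * c₁ ^ p * 2 ^ (-|e|) / (8 * (1 + μ)) * ε ^ p * a ^ (2 + e) := by
      rw [hK, Real.rpow_add a0]
      norm_cast
      field_simp
      ring
    rw [← e1]
    linarith [hhalf.1]
  · intro t ht
    have t0 : 0 < t := by linarith [ht.1]
    have h2 := hlow t ht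
    rw [← expMomentAccel_zero (α := α) (μ := μ) T u t] at h2
    have h3 : μ / t * (t - a / 2) ≤ μ := by
      rw [div_mul_eq_mul_div, div_le_iff₀ t0]
      nlinarith
    have h4 : K / (1 + μ) + μ / t * (K / (1 + μ) * (t - a / 2)) ≤ K := by
      have : K / (1 + μ) * (1 + μ / t * (t - a / 2)) ≤ K / (1 + μ) * (1 + μ) := by gcongr
      rw [div_mul_cancel₀ _ (by positivity)] at this
      linarith
    have : μ / t * (expMoment (velocity T u) 0 t - K / (1 + μ) * (t - a / 2))
      = μ / t * expMoment (velocity T u) 0 t - μ / t * (K / (1 + μ) * (t - a / 2)) := by ring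
    rw [this]
    linarith

/-- Apply the blow-up criterion with k = (c/2) ε^r a^σ, the half making k < F(a) strict. No solution
then outlives 2a, and the supremum inherits the bound. -/
theorem Admissible.lifespan_le_of_mean_lower (d : Admissible α μ p R u₀ u₁) {c a₀ r σ : ℝ}
    (hc : 0 < c) (ha₀ : 1 ≤ a₀)
    (H : ∀ ε : ℝ, 0 < ε → ∀ (T : EReal) (u : ℝ → EuclideanSpace ℝ (Fin n) → ℝ),
      IsClassicalSolution α μ p ε u₀ u₁ T u → ∀ a : ℝ, a₀ ≤ a → (a : EReal) < T →
        c * ε ^ r * a ^ σ ≤ expMoment u 0 a) :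
    ∃ D : ℝ, 0 < D ∧ ∀ ε : ℝ, 0 < ε → ∀ a : ℝ, a₀ ≤ a →
      D ≤ ε ^ (r * (p - 1)) * a ^ (σ * (p - 1) + 2 - (1 - α) * (n * (p - 1) + p)) →
      lifespan α μ p ε u₀ u₁ ≤ ((2 * a : ℝ) : EReal) := by
  obtain ⟨D, hD, HD⟩ := d.exists_blowup_criterion
  have hc2 : 0 < (c / 2) ^ (p - 1) := by positivity
  refine ⟨D / (c / 2) ^ (p - 1), by positivity, fun ε hε a ha hDa => sSup_le ?_⟩
  rintro T ⟨u, h⟩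
  by_contra hT
  rw [not_le] at hT
  have ha1 : 1 ≤ a := ha₀.trans ha
  have a0 : 0 < a := by linarith
  have haT : (a : EReal) < T := lt_trans (by exact_mod_cast (by linarith : a < 2 * a)) hT
  have hk : 0 < ε ^ r * a ^ σ := by positivity
  have h1 := H ε hε T u h a ha haT
  have h2 := HD ε hε T u h a (c / 2 * (ε ^ r * a ^ σ)) ha1 (by positivity) hT (by nlinarith)
  rw [div_le_iff₀ hc2] at hDa
  refine absurd h2 (not_lt.2 (hDa.trans (le_of_eq ?_)))
  rw [Real.mul_rpow (by positivity) hk.le, Real.mul_rpow (by positivity) (by positivity),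
    ← Real.rpow_mul hε.le, ← Real.rpow_mul a0.le, add_sub_assoc, Real.rpow_add a0]
  ring

/-- Solve ε^r a^θ ≥ D for a: a multiple of ε^(-r/θ) works, and ε ≤ 1 keeps it above a₀. For a fixed
arbitrary ε, the maximum with a₀ suffices for finiteness. -/
theorem lifespan_estimate_of_scaling {L : ℝ → EReal} {D a₀ r θ : ℝ} (hD : 0 < D) (ha₀ : 1 ≤ a₀)
    (hr : 0 ≤ r) (hθ : 0 < θ)
    (H : ∀ ε : ℝ, 0 < ε → ∀ a : ℝ, a₀ ≤ a → D ≤ ε ^ r * a ^ θ → L ε ≤ ((2 * a : ℝ) : EReal)) :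
    (∀ ε : ℝ, 0 < ε → L ε < ⊤) ∧ ∃ C : ℝ, 0 < C ∧ ∀ ε : ℝ, 0 < ε → ε ≤ 1 →
      L ε ≤ ((C * ε ^ (-(r / θ)) : ℝ) : EReal) := by
  constructor
  · intro ε hε
    have hεr : 0 < ε ^ r := Real.rpow_pos_of_pos hε _
    refine lt_of_le_of_lt (H ε hε (max a₀ ((D / ε ^ r) ^ θ⁻¹)) (le_max_left _ _) ?_)
      (EReal.coe_lt_top _)
    have h1 : D / ε ^ r ≤ max a₀ ((D / ε ^ r) ^ θ⁻¹) ^ θ := by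
      calc D / ε ^ r = ((D / ε ^ r) ^ θ⁻¹) ^ θ := (Real.rpow_inv_rpow (by positivity) hθ.ne').symm
        _ ≤ _ := Real.rpow_le_rpow (by positivity) (le_max_right _ _) hθ.le
    rw [div_le_iff₀ hεr] at h1
    linarith
  · set B := max a₀ (D ^ θ⁻¹) with hB
    have hB0 : 0 < B := lt_max_of_lt_left (by linarith)
    refine ⟨2 * B, by positivity, fun ε hε hε1 => ?_⟩
    have h1 : 1 ≤ ε ^ (-(r / θ)) := Real.one_le_rpow_of_pos_of_le_one_of_nonpos hε hε1
      (neg_nonpos.2 (by positivity))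
    have h2 := H ε hε (B * ε ^ (-(r / θ))) ?_ ?_
    · rwa [← mul_assoc] at h2
    · nlinarith [le_max_left a₀ (D ^ θ⁻¹)]
    · rw [Real.mul_rpow hB0.le (by positivity), ← Real.rpow_mul hε.le, neg_mul,
        div_mul_cancel₀ _ hθ.ne', Real.rpow_neg hε.le]
      have h3 : D ≤ B ^ θ := by
        calc D = (D ^ θ⁻¹) ^ θ := (Real.rpow_inv_rpow hD.le hθ.ne').symm
          _ ≤ _ := Real.rpow_le_rpow (by positivity) (le_max_right _ _) hθ.le
      refine h3.trans (le_of_eq ?_)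
      have := Real.rpow_pos_of_pos hε r
      field_simp

/-- Eliminating the leading coefficient A by the root equation gives pc² γ'(p) = p pc B (pc - p) +
2(pc² - p²), where B ≥ 0; no information on the sign of A is needed. -/
theorem gammaPrime_pos_of_lt {pc : ℝ} (hα₀ : 0 ≤ α) (hα₁ : α < 1) (hμ : 0 ≤ μ) (hp : 0 < p)
    (hpc : IsPcPrime n α μ pc) (hlt : p < pc) : 0 < gammaPrime n p α μ := by
  obtain ⟨h0, h1⟩ := hpc
  unfold gammaPrime at h1 ⊢
  have hβ : 0 < 1 - α := by linarith
  have hB : 0 ≤ (n : ℝ) + 1 + (μ + 3 * α) / (1 - α) := by positivity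
  set B := (n : ℝ) + 1 + (μ + 3 * α) / (1 - α)
  set A := (n : ℝ) + 1 + (μ - α) / (1 - α)
  have h2 : pc ^ 2 * (-p ^ 2 * A + p * B + 2)
      = p * pc * B * (pc - p) + 2 * (pc ^ 2 - p ^ 2) := by
    linear_combination p ^ 2 * h1
  have h3 : 0 < pc ^ 2 * (-p ^ 2 * A + p * B + 2) := by
    rw [h2]
    have h4 : 0 ≤ p * pc * B * (pc - p) :=
      mul_nonneg (by positivity) (by linarith)
    nlinarith
  exact pos_of_mul_pos_right h3 (sq_nonneg _)

theorem exponent_pos_of_lt_p0Prime (hα₀ : 0 ≤ α) (hp : 1 < p) (hlt : p < p0Prime n α μ) :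
    0 < (1 - μ - ((n : ℝ) + 1) * (1 - α)) * (p - 1) + 1 + α := by
  unfold p0Prime at hlt
  -- A negative denominator would give p_0' ≤ 1, and a zero one p_0' = 1 since division by zero is
  -- 0; both contradict 1 < p < p_0'.
  have hD : 0 < ((n : ℝ) + 1) * (1 - α) + μ - 1 := by
    by_contra hn
    have := div_nonpos_of_nonneg_of_nonpos (by linarith : 0 ≤ 1 + α) (not_lt.1 hn)
    linarith
  have h2 : p - 1 < (1 + α) / (((n : ℝ) + 1) * (1 - α) + μ - 1) := by linarith
  rw [lt_div_iff₀ hD] at h2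
  linarith

theorem Admissible.lifespan_of_lt_pcPrime (d : Admissible α μ p R u₀ u₁)
    (hp : ∃ pc, IsPcPrime n α μ pc ∧ p < pc) :
    (∀ ε : ℝ, 0 < ε → lifespan α μ p ε u₀ u₁ < ⊤) ∧ ∃ C : ℝ, 0 < C ∧ ∀ ε : ℝ, 0 < ε → ε ≤ 1 →
      lifespan α μ p ε u₀ u₁ ≤
        ((C * ε ^ (-(2 * p * (p - 1)) / ((1 - α) * gammaPrime n p α μ)) : ℝ) : EReal) := by
  obtain ⟨pc, hpc, hlt⟩ := hp
  have hp1 := d.one_lt_p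
  have hβ : 0 < 1 - α := by linarith [d.α_lt_one]
  have hγ := gammaPrime_pos_of_lt d.α_nonneg d.α_lt_one d.μ_nonneg (by linarith) hpc hlt
  obtain ⟨c, hc, H⟩ := d.exists_mean_lower_superlinear rfl
  obtain ⟨D, hD, HD⟩ := d.lifespan_le_of_mean_lower (a₀ := 4) hc (by norm_num) H
  -- The exponent identity behind this is (2 + e)(p-1) + 2 - (1-α)(n(p-1) + p) = (1-α)γ'/2.
  have key := lifespan_estimate_of_scaling (L := fun ε => lifespan α μ p ε u₀ u₁)
    (r := p * (p - 1)) (θ := (1 - α) * gammaPrime n p α μ / 2) hD (by norm_num : (1 : ℝ) ≤ 4)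
    (by nlinarith) (by positivity) (fun ε hε a ha hDa => HD ε hε a ha (by
      refine hDa.trans (le_of_eq ?_)
      congr 2
      unfold gammaPrime
      field_simp
      ring))
  have e : -(p * (p - 1) / ((1 - α) * gammaPrime n p α μ / 2))
      = -(2 * p * (p - 1)) / ((1 - α) * gammaPrime n p α μ) := by
    field_simp
  rwa [e] at key

theorem Admissible.lifespan_of_lt_p0Prime (d : Admissible α μ p R u₀ u₁)
    (hp : p < p0Prime n α μ) :
    (∀ ε : ℝ, 0 < ε → lifespan α μ p ε u₀ u₁ < ⊤) ∧ ∃ C : ℝ, 0 < C ∧ ∀ ε : ℝ, 0 < ε → ε ≤ 1 →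
      lifespan α μ p ε u₀ u₁ ≤ ((C * ε ^ (-((p - 1) /
        ((1 - μ - ((n : ℝ) + 1) * (1 - α)) * (p - 1) + 1 + α))) : ℝ) : EReal) := by
  have hp1 := d.one_lt_p
  have hθ := exponent_pos_of_lt_p0Prime d.α_nonneg hp1 hp
  obtain ⟨c, hc, H⟩ := d.exists_mean_lower_linear
  obtain ⟨D, hD, HD⟩ := d.lifespan_le_of_mean_lower (a₀ := 1) (r := 1) hc le_rfl
    (by simpa only [Real.rpow_one] using H)
  exact lifespan_estimate_of_scaling hD le_rfl (by linarith) hθ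
    (fun ε hε a ha hDa => HD ε hε a ha (by
      refine hDa.trans (le_of_eq ?_)
      congr 2
      · ring
      · ring))

theorem coe_mul_rpow_mono {C C' ε s : ℝ} (hε : 0 < ε) (h : C ≤ C') :
    ((C * ε ^ s : ℝ) : EReal) ≤ ((C' * ε ^ s : ℝ) : EReal) := by
  have := Real.rpow_pos_of_pos hε s
  exact_mod_cast mul_le_mul_of_nonneg_right h this.le

end

end DampedWave

/-! ### The lifespan theorem -/

theorem theorem3p1 (n : ℕ) (hn : 2 ≤ n) (α μ p R : ℝ) (hα₀ : 0 ≤ α) (hα₁ : α < 1) (hμ : 0 ≤ μ)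
    (hp₁ : 1 < p)
    (hp : (∃ pc, DampedWave.IsPcPrime n α μ pc ∧ p < pc) ∨ p < DampedWave.p0Prime n α μ)
    (hR : 0 < R) (u₀ u₁ : EuclideanSpace ℝ (Fin n) → ℝ)
    (hu₀ : ContDiff ℝ 2 u₀) (hu₁ : ContDiff ℝ 1 u₁)
    (hu₀_nonneg : ∀ x, 0 ≤ u₀ x) (hu₁_nonneg : ∀ x, 0 ≤ u₁ x)
    (hu₀_ne : u₀ ≠ 0) (hu₁_ne : u₁ ≠ 0)
    (hu₀_supp : tsupport u₀ ⊆ Metric.closedBall 0 R)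
    (hu₁_supp : tsupport u₁ ⊆ Metric.closedBall 0 R) :
    (∀ ε : ℝ, 0 < ε → DampedWave.lifespan α μ p ε u₀ u₁ < ⊤) ∧
    ∃ ε₀ : ℝ, 0 < ε₀ ∧ ∃ C : ℝ, 0 < C ∧ ∀ ε : ℝ, 0 < ε → ε ≤ ε₀ →
      ((∃ pc, DampedWave.IsPcPrime n α μ pc ∧ p < pc) →
        DampedWave.lifespan α μ p ε u₀ u₁ ≤
          ((C * ε ^ (-(2 * p * (p - 1)) / ((1 - α) * DampedWave.gammaPrime n p α μ)) : ℝ)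
            : EReal)) ∧
      (p < DampedWave.p0Prime n α μ →
        DampedWave.lifespan α μ p ε u₀ u₁ ≤
          ((C * ε ^ (-((p - 1) /
            ((1 - μ - ((n : ℝ) + 1) * (1 - α)) * (p - 1) + 1 + α))) : ℝ) : EReal)) := by
  have d : DampedWave.Admissible α μ p R u₀ u₁ := ⟨by omega, hα₀, hα₁, hμ, hp₁, hR,
    hu₀.continuous, hu₁.continuous, hu₀_nonneg, hu₁_nonneg, hu₀_ne, hu₁_ne, hu₀_supp, hu₁_supp⟩
  refine ⟨hp.elim (fun h => (d.lifespan_of_lt_pcPrime h).1)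
    fun h => (d.lifespan_of_lt_p0Prime h).1, 1, one_pos, ?_⟩
  -- One constant must serve both implications: the maximum when both ranges apply, otherwise the
  -- single one available.
  by_cases h1 : ∃ pc, DampedWave.IsPcPrime n α μ pc ∧ p < pc <;>
    by_cases h2 : p < DampedWave.p0Prime n α μ
  · obtain ⟨C₁, hC₁, H₁⟩ := (d.lifespan_of_lt_pcPrime h1).2
    obtain ⟨C₂, hC₂, H₂⟩ := (d.lifespan_of_lt_p0Prime h2).2
    exact ⟨max C₁ C₂, lt_max_of_lt_left hC₁, fun ε hε hε1 =>
      ⟨fun _ => (H₁ ε hε hε1).trans (DampedWave.coe_mul_rpow_mono hε (le_max_left _ _)),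
        fun _ => (H₂ ε hε hε1).trans (DampedWave.coe_mul_rpow_mono hε (le_max_right _ _))⟩⟩
  · obtain ⟨C₁, hC₁, H₁⟩ := (d.lifespan_of_lt_pcPrime h1).2
    exact ⟨C₁, hC₁, fun ε hε hε1 => ⟨fun _ => H₁ ε hε hε1, fun h => absurd h h2⟩⟩
  · obtain ⟨C₂, hC₂, H₂⟩ := (d.lifespan_of_lt_p0Prime h2).2
    exact ⟨C₂, hC₂, fun ε hε hε1 => ⟨fun h => absurd h h1, fun _ => H₂ ε hε hε1⟩⟩
  · exact absurd hp (not_or.2 ⟨h1, h2⟩)
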